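/- Let $m\ge 2$ and let $D,\Omega\subset\mathbb{R}^m$ be bounded open domains (nonempty, open, connected) with $C^1$ boundaries, meaning that near each boundary point $p$ the domain is $\{\rho<0\}$ for some $C^1$ function $\rho$ with $\rho(p)=0$ and $\mathrm{d}\rho(p)\neq 0$. Assume that $\partial\Omega$ can be singly parametrized: there are a Jordan measurable bounded closed domain $U\subset\mathbb{R}^{m-1}$ (the closure of a bounded open domain, with $\partial U$ of measure zero) and a $C^1$ map $x:U\to\mathbb{R}^m$, injective and with Jacobian matrix of rank $m-1$ on the interior of $U$, such that $\partial\Omega=x(U)$. Let $\varphi:\overline{\Omega}\to\overline{D}$ be a $C^1$ map which maps $\partial\Omega$ diffeomorphically onto $\partial D$ (that is, $\varphi|_{\partial\Omega}:\partial\Omega\to\partial D$ is a bijection with $C^1$ inverse), and let $f:\overline{D}\to\mathbb{R}$ be continuous. If the Jacobian determinant $J_\varphi(x)=\det\varphi'(x)$ does not change sign on $\Omega$ (that is, $J_\varphi\ge 0$ on all of $\Omega$ or $J_\varphi\le 0$ on all of $\Omega$), then both integrals below exist and $$\int_D f(y)\,\mathrm{d}y=\int_\Omega f(\varphi(x))\,|J_\varphi(x)|\,\mathrm{d}x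 .$$ -/

import Mathlib

open MeasureTheory Set
open scoped Topology

/-- `ℝᵐ` with its Euclidean norm. -/
abbrev Euc (m : ℕ) : Type := EuclideanSpace ℝ (Fin m)

/-- A bounded open domain: a bounded, open, nonempty, connected set. -/
structure IsBoundedDomain {m : ℕ} (Ω : Set (Euc m)) : Prop where
  isOpen : IsOpen Ω
  isConnected : IsConnected Ω
  isBounded : Bornology.IsBounded Ω

/-- `Ω` has a `C¹` boundary: near each boundary point, `Ω` is the strict sublevel set `{ρ < 0}` of
a `C¹` function `ρ` vanishing at that point and whose differential there is nonzero. -/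
def HasC1Boundary {m : ℕ} (Ω : Set (Euc m)) : Prop :=
  ∀ p ∈ frontier Ω, ∃ (W : Set (Euc m)) (ρ : Euc m → ℝ),
    IsOpen W ∧ p ∈ W ∧ ContDiffOn ℝ 1 ρ W ∧ ρ p = 0 ∧ fderiv ℝ ρ p ≠ 0 ∧
      Ω ∩ W = {x | x ∈ W ∧ ρ x < 0}

/-- A Jordan measurable bounded closed domain: a bounded set which is the closure of its nonempty
connected interior (equivalently, the closure of a bounded open domain) and whose boundary has
measure zero. -/
structure IsJordanClosedDomain {k : ℕ} (U : Set (Euc k)) : Prop where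
  closure_interior : closure (interior U) = U
  isConnected_interior : IsConnected (interior U)
  isBounded : Bornology.IsBounded U
  volume_frontier : volume (frontier U) = 0

/-- `x : U → ℝᵐ` is a `C¹`-parametrized surface of dimension `k`: a `C¹` map on a Jordan measurable
bounded closed domain of `ℝᵏ`, which on the interior is injective and has Jacobian matrix of rank
`k`. (As in the usual spherical coordinates, the rank may drop on the boundary of `U`.) -/
structure IsC1ParametrizedSurface {k m : ℕ} (U : Set (Euc k)) (x : Euc k → Euc m) : Prop where
  domain : IsJordanClosedDomain U
  contDiffOn : ContDiffOn ℝ 1 x U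
  injOn_interior : InjOn x (interior U)
  rank_eq : ∀ u ∈ interior U,
    Module.finrank ℝ (LinearMap.range (fderiv ℝ x u : Euc k →ₗ[ℝ] Euc m)) = k

/-- `S ⊆ ℝᵐ` can be singly parametrized: it is the image of one `C¹`-parametrized surface whose
parameter domain lies in `ℝᵐ⁻¹`. -/
def IsSinglyParametrized {m : ℕ} (S : Set (Euc m)) : Prop :=
  ∃ (U : Set (Euc (m - 1))) (x : Euc (m - 1) → Euc m),
    IsC1ParametrizedSurface U x ∧ S = x '' U

/-- `φ` maps `A` onto `B` diffeomorphically (class `C¹`): `φ` is `C¹` on `A`, and it is a bijection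
from `A` onto `B` with an inverse `ψ` that is `C¹` on `B`. -/
def MapsDiffeomorphically {m : ℕ} (φ : Euc m → Euc m) (A B : Set (Euc m)) : Prop :=
  ContDiffOn ℝ 1 φ A ∧ MapsTo φ A B ∧
    ∃ ψ : Euc m → Euc m, ContDiffOn ℝ 1 ψ B ∧ MapsTo ψ B A ∧ InvOn ψ φ A B

/-- The Jacobian determinant `J_φ(x) = det φ'(x)`. -/
noncomputable def jacobianDet {m : ℕ} (φ : Euc m → Euc m) (x : Euc m) : ℝ :=
  (fderiv ℝ φ x).det

/-!
The hypotheses force `φ` to have degree `±1` over `D`; as `J_φ` does not change sign, the image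
under `φ` of the measure `|J_φ| dx` on `Ω` is then Lebesgue measure on `D`. The degree is handled
through integrals of Lipschitz maps only.

* The Jacobian determinant of a compactly supported Lipschitz map `u` of `ℝᵐ` has integral zero
  (`LipschitzWith.integral_det_fderiv_eq_zero`): for small `t` the map `id + t u` is a
  homeomorphism preserving large balls, so the integral of `det (1 + t Du)` over such a ball, a
  polynomial in `t`, is constant.
* Consequently, for `Φ` Lipschitz and `U` bounded and open, the distribution
  `h ↦ ∫_U (h ∘ Φ) det DΦ` has zero derivatives off `Φ(∂U)`
  (`LipschitzWith.setIntegral_fderiv_mul_det_fderiv_eq_zero`), so on a connected open set `V`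
  disjoint from `Φ(∂U)` it is `c` times Lebesgue measure (`exists_integral_comp_mul_eq_const_mul`).
  If `Φ` covers some nonempty open part of `V` exactly once, then `c = ±1`
  (`LipschitzWith.exists_degree_eq_one_or_neg_one`).
* In charts straightening `∂Ω` near a point `p` and `∂D` near `q = φ p`, the boundary map is
  extended to the outside of `Ω` by preserving the transversal coordinate
  (`BoundaryChart.exists_extend`). The extension of `φ` to `U = Ω ∪ ball p s` covers the outside of
  `D` near `q` exactly once, and `V = D ∪ ball q r` is disjoint from the image of `∂U` for
  small `r`. Hence `c = ±1` on all of `D` (`exists_lipschitz_extension_integral_comp_mul_det`).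
* With `|J_φ| = ε J_φ`, positivity gives `ε c = 1`. No mass is carried by `∂D`, which is a null set,
  because the preimage of a null set consists almost entirely of critical points
  (`volume_preimage_inter_det_fderiv_ne_zero`).
-/

/-! ### Jacobian determinants of Lipschitz maps -/

section Lipschitz

open scoped NNReal

variable {E : Type*} [NormedAddCommGroup E] [NormedSpace ℝ E] [FiniteDimensional ℝ E]

theorem LipschitzWith.exists_abs_det_fderiv_le {f : E → E} {K : ℝ≥0} (hf : LipschitzWith K f) :
    ∃ C, ∀ x, |(fderiv ℝ f x).det| ≤ C := by
  obtain ⟨C, hC⟩ := (isCompact_closedBall (0 : E →L[ℝ] E) K).exists_bound_of_continuousOn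
    (f := ContinuousLinearMap.det) ContinuousLinearMap.continuous_det.continuousOn
  exact ⟨C, fun x => hC _ (by simpa using norm_fderiv_le_of_lipschitz ℝ hf)⟩

/-- `t ↦ det (1 + t A)` is a polynomial with leading coefficient `det A`, so `det A` is a
combination, with weights independent of `A`, of its values at `dim E + 1` nodes; the weights add
up to the leading coefficient of the constant polynomial `1`, which is `0`. -/
theorem exists_det_eq_sum_det_one_add_smul [Nontrivial E] (v : ℕ → ℝ)
    (hv : Function.Injective v) :
    ∃ (s : Finset ℕ) (w : ℕ → ℝ), ∑ j ∈ s, w j = 0 ∧ ∀ A : E →L[ℝ] E,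
      A.det = ∑ j ∈ s, w j * (ContinuousLinearMap.id ℝ E + v j • A).det := by
  classical
  set d := Module.finrank ℝ E with hd
  have hdpos : 0 < d := Module.finrank_pos
  let s := Finset.range (d + 1)
  have hvs : Set.InjOn v s := hv.injOn
  let w : ℕ → ℝ := fun i => (∏ j ∈ s.erase i, (v i - v j))⁻¹
  have hcard : s.card = d + 1 := Finset.card_range _
  refine ⟨s, w, ?_, fun A => ?_⟩
  · have h := Lagrange.coeff_eq_sum hvs (P := (1 : Polynomial ℝ)) (by
      rw [Polynomial.degree_one, hcard]; exact_mod_cast Nat.succ_pos d)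
    rw [hcard, Nat.add_sub_cancel, Polynomial.coeff_one, if_neg hdpos.ne'] at h
    rw [h]
    exact Finset.sum_congr rfl fun i _ => by simp [w]
  · let b := Module.finBasis ℝ E
    let M := LinearMap.toMatrix b b (A : E →ₗ[ℝ] E)
    let P : Polynomial ℝ := ((Polynomial.X : Polynomial ℝ) • M.map Polynomial.C
      + (1 : Matrix (Fin d) (Fin d) ℝ).map Polynomial.C).det
    have hdeg : P.degree < s.card := by
      refine (Polynomial.degree_le_of_natDegree_le
        (Polynomial.natDegree_det_X_add_C_le M 1)).trans_lt ?_
      rw [hcard, Fintype.card_fin]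
      exact_mod_cast Nat.lt_succ_self d
    have h := Lagrange.coeff_eq_sum hvs hdeg
    have hA : A.det = M.det := by
      simp [M, ContinuousLinearMap.det]
    have hcoef : P.coeff d = M.det := by
      have := Polynomial.coeff_det_X_add_C_card M 1
      rwa [Fintype.card_fin] at this
    have heval : ∀ t, P.eval t = (ContinuousLinearMap.id ℝ E + t • A).det := by
      intro t
      have h1 : P.eval t = (t • M + 1).det := by
        change Polynomial.eval t (Matrix.det _) = _
        rw [← Polynomial.coe_evalRingHom, RingHom.map_det]
        congr 1
        ext i j
        by_cases hij : i = j <;> simp [hij] <;> exact mul_comm _ _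
      rw [h1, ContinuousLinearMap.det, ← LinearMap.det_toMatrix b]
      congr 1
      simp [M, add_comm]
    rw [hcard, Nat.add_sub_cancel, hcoef] at h
    rw [hA, h]
    exact Finset.sum_congr rfl fun i _ => by rw [heval, div_eq_mul_inv, mul_comm]

variable [MeasurableSpace E] [BorelSpace E] {μ : Measure E}

theorem measurable_det_fderiv (f : E → E) : Measurable fun x => (fderiv ℝ f x).det :=
  ContinuousLinearMap.continuous_det.measurable.comp (measurable_fderiv ℝ f)

theorem LipschitzWith.integrableOn_det_fderiv {f : E → E} {K : ℝ≥0} (hf : LipschitzWith K f)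
    {s : Set E} (hs : μ s ≠ ⊤) : IntegrableOn (fun x => (fderiv ℝ f x).det) s μ := by
  obtain ⟨C, hC⟩ := hf.exists_abs_det_fderiv_le
  exact Measure.integrableOn_of_bounded hs (measurable_det_fderiv f).aestronglyMeasurable
    (Filter.Eventually.of_forall hC)

variable [μ.IsAddHaarMeasure]

theorem LipschitzWith.addHaar_image_eq_zero {f : E → E} {K : ℝ≥0} (hf : LipschitzWith K f)
    {s : Set E} (hs : μ s = 0) : μ (f '' s) = 0 := by
  have h1 : μ ≪ μH[(Module.finrank ℝ E : ℝ)] :=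
    Measure.absolutelyContinuous_isAddHaarMeasure _ _
  have h2 : μH[(Module.finrank ℝ E : ℝ)] ≪ μ :=
    Measure.absolutelyContinuous_isAddHaarMeasure _ _
  apply h1
  have := hf.hausdorffMeasure_image_le (d := (Module.finrank ℝ E : ℝ)) (by positivity) s
  rw [h2 hs, mul_zero] at this
  exact le_antisymm this bot_le

/-- The change of variables formula for Lipschitz maps: by Rademacher's theorem it suffices to
treat the points of differentiability, the image of the other points being a null set. -/
theorem LipschitzWith.lintegral_abs_det_fderiv_eq_addHaar_image {f : E → E} {K : ℝ≥0}
    (hf : LipschitzWith K f) {s : Set E} (hs : MeasurableSet s) (hinj : InjOn f s) :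
    ∫⁻ x in s, ENNReal.ofReal |(fderiv ℝ f x).det| ∂μ = μ (f '' s) := by
  set t : Set E := s ∩ {x | DifferentiableAt ℝ f x} with ht
  have htm : MeasurableSet t := hs.inter (measurableSet_of_differentiableAt ℝ f)
  have hnull : μ (s \ t) = 0 := by
    refine measure_mono_null ?_ (ae_iff.1 hf.ae_differentiableAt)
    rintro x ⟨hxs, hxt⟩ hx
    exact hxt ⟨hxs, hx⟩
  have hst : (s : Set E) =ᵐ[μ] t :=
    (sdiff_null_ae_eq_self hnull).symm.trans (by rw [ht]; simp; rfl)
  rw [setLIntegral_congr hst, MeasureTheory.lintegral_abs_det_fderiv_eq_addHaar_image μ htm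
    (fun x hx => hx.2.hasFDerivAt.hasFDerivWithinAt) (hinj.mono inter_subset_left)]
  refine le_antisymm (measure_mono (image_mono inter_subset_left)) ?_
  calc μ (f '' s) ≤ μ (f '' t ∪ f '' (s \ t)) := by
        rw [← image_union, union_sdiff_cancel inter_subset_left]
    _ ≤ μ (f '' t) + μ (f '' (s \ t)) := measure_union_le _ _
    _ = μ (f '' t) := by rw [hf.addHaar_image_eq_zero hnull, add_zero]

/-- For small `t` the map `id + t u` is a homeomorphism which preserves every ball that contains
the support of `u`, so its Jacobian integrates to the volume of the ball. -/
theorem LipschitzWith.exists_integral_det_one_add_smul_fderiv_eq {u : E → E} {K : ℝ≥0}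
    (hu : LipschitzWith K u) {R : ℝ} (hR : ∀ x, x ∉ Metric.ball (0 : E) R → u x = 0) :
    ∃ δ > 0, ∀ t : ℝ, 0 < t → t < δ →
      ∫ x in Metric.ball (0 : E) R, (ContinuousLinearMap.id ℝ E + t • fderiv ℝ u x).det ∂μ
        = μ.real (Metric.ball (0 : E) R) := by
  obtain ⟨η, hη, hdet⟩ : ∃ η > 0, ∀ M : E →L[ℝ] E, dist M (ContinuousLinearMap.id ℝ E) < η →
      0 < M.det := by
    have : ∀ᶠ M : E →L[ℝ] E in 𝓝 (ContinuousLinearMap.id ℝ E), 0 < M.det := by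
      apply ContinuousLinearMap.continuous_det.continuousAt.eventually
      apply lt_mem_nhds
      simp [ContinuousLinearMap.det]
    simpa using Metric.eventually_nhds_iff.1 this
  refine ⟨min 1 η / (K + 1), by positivity, fun t ht0 ht => ?_⟩
  have hK : (0 : ℝ) ≤ K := K.2
  have htK : t * (K + 1) < min 1 η := (lt_div_iff₀ (by positivity)).1 ht
  have htK1 : t * K < 1 := by nlinarith [min_le_left 1 η]
  have htKη : t * K < η := by nlinarith [min_le_right 1 η]
  set B := Metric.ball (0 : E) R
  let T : E → E := fun x => x + t • u x
  have happ : ApproximatesLinearOn T ((ContinuousLinearEquiv.refl ℝ E : E ≃L[ℝ] E) : E →L[ℝ] E)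
      univ (t.toNNReal * K) := by
    rw [ApproximatesLinearOn.approximatesLinearOn_iff_lipschitzOnWith, lipschitzOnWith_univ]
    have : (T - ((ContinuousLinearEquiv.refl ℝ E : E ≃L[ℝ] E) : E →L[ℝ] E)) = fun x => t • u x := by
      ext x; simp [T]
    rw [this]
    have := (lipschitzWith_smul (β := E) t).comp hu
    rwa [show ‖t‖₊ = t.toNNReal by
      rw [← Real.toNNReal_eq_nnnorm_of_nonneg ht0.le]] at this
  have hc : Subsingleton E ∨ t.toNNReal * K <
      ‖((ContinuousLinearEquiv.refl ℝ E).symm : E →L[ℝ] E)‖₊⁻¹ := by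
    rcases subsingleton_or_nontrivial E with h | h
    · exact Or.inl h
    · right
      have : ‖((ContinuousLinearEquiv.refl ℝ E).symm : E →L[ℝ] E)‖₊ = 1 := by
        ext; simp
      rw [this, inv_one, ← NNReal.coe_lt_coe]
      simpa [Real.coe_toNNReal t ht0.le] using htK1
  have hTinj : Function.Injective T := by
    have := happ.injOn hc
    exact fun x y h => this (mem_univ x) (mem_univ y) h
  have hTsurj : Function.Surjective T := happ.surjective hc
  have hTout : ∀ x, x ∉ B → T x = x := fun x hx => by simp [T, hR x hx]
  have hTB : T '' B = B := by
    have hcompl : T '' Bᶜ = Bᶜ := by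
      ext y
      constructor
      · rintro ⟨x, hx, rfl⟩; rwa [hTout x hx]
      · exact fun hy => ⟨y, hy, hTout y hy⟩
    have := image_compl_eq ⟨hTinj, hTsurj⟩ (s := B)
    rw [hcompl] at this
    exact (compl_injective this).symm
  have hTL : LipschitzWith (1 + ‖t‖₊ * K) T :=
    LipschitzWith.id.add ((lipschitzWith_smul (β := E) t).comp hu)
  have hder : ∀ᵐ x ∂μ, fderiv ℝ T x = ContinuousLinearMap.id ℝ E + t • fderiv ℝ u x := by
    filter_upwards [hu.ae_differentiableAt] with x hx
    exact ((hasFDerivAt_id x).add (hx.hasFDerivAt.const_smul t)).fderiv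
  have hpos : ∀ x, 0 < (ContinuousLinearMap.id ℝ E + t • fderiv ℝ u x).det := by
    intro x
    apply hdet
    rw [dist_eq_norm, add_sub_cancel_left, norm_smul, Real.norm_of_nonneg ht0.le]
    exact (mul_le_mul_of_nonneg_left (norm_fderiv_le_of_lipschitz ℝ hu) ht0.le).trans_lt htKη
  have hm : Measurable fun x => (ContinuousLinearMap.id ℝ E + t • fderiv ℝ u x).det :=
    ContinuousLinearMap.continuous_det.measurable.comp
      (((measurable_fderiv ℝ u).const_smul t).const_add _)
  have key := hTL.lintegral_abs_det_fderiv_eq_addHaar_image (μ := μ)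
    (s := B) Metric.isOpen_ball.measurableSet hTinj.injOn
  rw [hTB] at key
  rw [integral_eq_lintegral_of_nonneg_ae (Filter.Eventually.of_forall fun x => (hpos x).le)
    hm.aestronglyMeasurable, measureReal_def, ← key]
  congr 1
  refine lintegral_congr_ae ?_
  filter_upwards [ae_restrict_of_ae hder] with x hx
  rw [hx, abs_of_pos (hpos x)]

/-- The Jacobian determinant of a compactly supported Lipschitz map has integral zero. The
integral of `det (1 + t Du)` over a large ball is a polynomial in `t`, constant for small `t`, and
the integral of `det Du` is its coefficient of highest degree. -/
theorem LipschitzWith.integral_det_fderiv_eq_zero [Nontrivial E] {u : E → E} {K : ℝ≥0}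
    (hu : LipschitzWith K u) (hc : HasCompactSupport u) :
    ∫ x, (fderiv ℝ u x).det ∂μ = 0 := by
  obtain ⟨R, hRpos, hR⟩ := hc.isBounded.subset_ball_lt 0 (0 : E)
  have hR0 : ∀ x, x ∉ Metric.ball (0 : E) R → u x = 0 := fun x hx =>
    image_eq_zero_of_notMem_tsupport fun h => hx (hR h)
  obtain ⟨δ, hδ, hδ'⟩ := hu.exists_integral_det_one_add_smul_fderiv_eq (μ := μ) hR0
  -- Any infinite family of nodes in `(0, δ)` would do.
  let v : ℕ → ℝ := fun j => δ / (j + 2)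
  have hv : Function.Injective v := by
    intro i j hij
    have hi : (0 : ℝ) < (i : ℝ) + 2 := by positivity
    have hj : (0 : ℝ) < (j : ℝ) + 2 := by positivity
    simp only [v] at hij
    rw [div_eq_div_iff hi.ne' hj.ne'] at hij
    have := mul_left_cancel₀ hδ.ne' hij
    exact_mod_cast (add_right_cancel this).symm
  have hv0 : ∀ j, 0 < v j := fun j => by positivity
  have hvδ : ∀ j, v j < δ := fun j => div_lt_self hδ (by
    have : (0 : ℝ) ≤ j := Nat.cast_nonneg j
    linarith)
  obtain ⟨s, w, hw, hs⟩ := exists_det_eq_sum_det_one_add_smul (E := E) v hv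
  have h0 : ∫ x, (fderiv ℝ u x).det ∂μ
      = ∫ x in Metric.ball (0 : E) R, (fderiv ℝ u x).det ∂μ := by
    refine (setIntegral_eq_integral_of_forall_compl_eq_zero fun x hx => ?_).symm
    have : fderiv ℝ u x = 0 := by
      by_contra h
      exact hx (hR (support_fderiv_subset ℝ h))
    rw [this]
    simp [ContinuousLinearMap.det]
  -- A function that is not integrable would have integral `0`, not the volume of the ball.
  have hint : ∀ j, IntegrableOn (fun x => w j *
      (ContinuousLinearMap.id ℝ E + v j • fderiv ℝ u x).det) (Metric.ball (0 : E) R) μ := by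
    intro j
    refine Integrable.const_mul ?_ _
    by_contra hni
    have h := hδ' (v j) (hv0 j) (hvδ j)
    rw [integral_undef hni] at h
    exact (Metric.measure_ball_pos μ (0 : E) hRpos).ne'
      ((measureReal_eq_zero_iff measure_ball_lt_top.ne).1 h.symm)
  rw [h0, setIntegral_congr_fun Metric.isOpen_ball.measurableSet
    (fun x _ => hs (fderiv ℝ u x)), integral_finsetSum _ fun j _ => hint j]
  simp_rw [integral_const_mul]
  rw [Finset.sum_congr rfl fun j _ => by rw [hδ' (v j) (hv0 j) (hvδ j)], ← Finset.sum_mul, hw,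
    zero_mul]

end Lipschitz

/-! ### The degree integral of a Lipschitz map -/

section DegreeIntegral

open scoped NNReal

section

variable {E F : Type*} [NormedAddCommGroup E]

theorem LipschitzWith.exists_hasCompactSupport_eqOn_ball [ProperSpace E] [NormedAddCommGroup F]
    [NormedSpace ℝ F] {f : E → F} {K : ℝ≥0} (hf : LipschitzWith K f) {R : ℝ} (hR : 0 ≤ R) :
    ∃ (K' : ℝ≥0) (ψ : E → F), LipschitzWith K' ψ ∧ HasCompactSupport ψ ∧
      EqOn ψ f (Metric.ball 0 R) := by
  let χ : E → ℝ := fun x => max (min (R + 1 - ‖x‖) 1) 0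
  have hχL : LipschitzWith 1 χ := by
    have h1 : LipschitzWith 1 fun x : E => R + 1 - ‖x‖ :=
      LipschitzWith.of_dist_le_mul fun x y => by
        rw [NNReal.coe_one, one_mul, dist_sub_left]
        simpa using lipschitzWith_one_norm.dist_le_mul x y
    exact (h1.min_const 1).max_const 0
  have hχ0 : ∀ x, x ∉ Metric.closedBall (0 : E) (R + 1) → χ x = 0 := by
    intro x hx
    have : R + 1 < ‖x‖ := by simpa using hx
    exact max_eq_right ((min_le_left _ _).trans (by linarith))
  have hχ1 : ∀ x, |χ x| ≤ 1 := fun x => by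
    rw [abs_of_nonneg (le_max_right _ _)]
    exact max_le (min_le_right _ _) zero_le_one
  obtain ⟨M, hM⟩ := (isCompact_closedBall (0 : E) (R + 1)).exists_bound_of_continuousOn
    hf.continuous.continuousOn
  have hM0 : 0 ≤ M := (norm_nonneg _).trans (hM 0 (by simp; linarith))
  have key : ∀ x ∈ Metric.closedBall (0 : E) (R + 1), ∀ y,
      dist (χ x • f x) (χ y • f y) ≤ (M + K) * dist x y := by
    intro x hx y
    have h1 : χ x • f x - χ y • f y = (χ x - χ y) • f x + χ y • (f x - f y) := by
      rw [sub_smul, smul_sub]; abel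
    rw [dist_eq_norm, h1, add_mul]
    refine (norm_add_le _ _).trans (add_le_add ?_ ?_)
    · rw [norm_smul, mul_comm]
      have := hχL.dist_le_mul x y
      rw [NNReal.coe_one, one_mul, dist_eq_norm] at this
      exact mul_le_mul (hM x hx) this (norm_nonneg _) hM0
    · rw [norm_smul, ← dist_eq_norm]
      exact (mul_le_of_le_one_left dist_nonneg (hχ1 y)).trans (hf.dist_le_mul x y)
  refine ⟨M.toNNReal + K, fun x => χ x • f x, LipschitzWith.of_dist_le_mul fun x y => ?_, ?_, ?_⟩
  · rw [NNReal.coe_add, Real.coe_toNNReal M hM0]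
    by_cases hx : x ∈ Metric.closedBall (0 : E) (R + 1)
    · exact key x hx y
    by_cases hy : y ∈ Metric.closedBall (0 : E) (R + 1)
    · rw [dist_comm, dist_comm x]; exact key y hy x
    · rw [hχ0 x hx, hχ0 y hy, zero_smul, zero_smul, dist_self]; positivity
  · exact HasCompactSupport.intro (isCompact_closedBall (0 : E) (R + 1)) fun x hx => by
      rw [hχ0 x hx, zero_smul]
  · intro x hx
    have hx' : ‖x‖ < R := by simpa using hx
    have : χ x = 1 := by
      simp only [χ]
      rw [min_eq_right (by linarith), max_eq_left zero_le_one]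
    simp [this]

variable [NormedSpace ℝ E]

theorem exists_mem_frontier_dist_add_dist_eq {s : Set E} {x y : E} (hx : x ∈ s) (hy : y ∉ s) :
    ∃ z ∈ frontier s, z ∈ segment ℝ x y ∧ dist x z + dist z y = dist x y := by
  obtain ⟨z, hz, hzs⟩ : ∃ z ∈ segment ℝ x y, z ∈ frontier s := by
    by_contra! h
    have hxi : x ∈ interior s := by_contra fun h' =>
      h x (left_mem_segment ℝ x y) ⟨subset_closure hx, h'⟩
    have hyc : y ∈ (closure s)ᶜ := fun h' =>
      h y (right_mem_segment ℝ x y) ⟨h', fun h'' => hy (interior_subset h'')⟩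
    obtain ⟨z, -, hz, hz'⟩ := (convex_segment (𝕜 := ℝ) x y).isPreconnected _ _ isOpen_interior
      isClosed_closure.isOpen_compl
      (fun z hz => or_iff_not_imp_left.2 fun h' h'' => h z hz ⟨h'', h'⟩)
      ⟨x, left_mem_segment ℝ x y, hxi⟩ ⟨y, right_mem_segment ℝ x y, hyc⟩
    exact hz' (subset_closure (interior_subset hz))
  exact ⟨z, hzs, hz, dist_add_dist_of_mem_segment hz⟩

theorem LipschitzWith.indicator_of_frontier [NormedAddCommGroup F] {f : E → F} {K : ℝ≥0}
    (hf : LipschitzWith K f) {s : Set E} (h : ∀ z ∈ frontier s, f z = 0) :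
    LipschitzWith K (s.indicator f) := by
  have key : ∀ x ∈ s, ∀ y ∉ s, dist (s.indicator f x) (s.indicator f y) ≤ K * dist x y := by
    intro x hx y hy
    obtain ⟨z, hz, -, hd⟩ := exists_mem_frontier_dist_add_dist_eq hx hy
    rw [indicator_of_mem hx, indicator_of_notMem hy, ← h z hz]
    exact (hf.dist_le_mul x z).trans (by
      gcongr; rw [← hd]; exact le_add_of_nonneg_right dist_nonneg)
  refine LipschitzWith.of_dist_le_mul fun x y => ?_
  by_cases hx : x ∈ s <;> by_cases hy : y ∈ s
  · rw [indicator_of_mem hx, indicator_of_mem hy]; exact hf.dist_le_mul x y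
  · exact key x hx y hy
  · rw [dist_comm, dist_comm x]; exact key y hy x hx
  · rw [indicator_of_notMem hx, indicator_of_notMem hy, dist_self]; positivity

end

variable {E : Type*} [NormedAddCommGroup E] [NormedSpace ℝ E] [FiniteDimensional ℝ E]

theorem ContinuousLinearMap.det_id_add_smulRight_comp (l : E →L[ℝ] ℝ) (v : E) (A : E →L[ℝ] E) :
    ((ContinuousLinearMap.id ℝ E + l.smulRight v).comp A).det = (1 + l v) * A.det := by
  have h := LinearMap.transvection.det (l : E →ₗ[ℝ] ℝ) v
  rw [ContinuousLinearMap.det, ContinuousLinearMap.det]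
  have h2 : (((ContinuousLinearMap.id ℝ E + l.smulRight v).comp A : E →L[ℝ] E) : E →ₗ[ℝ] E)
      = (LinearMap.transvection (l : E →ₗ[ℝ] ℝ) v) ∘ₗ (A : E →ₗ[ℝ] E) := by
    ext x; simp [LinearMap.transvection.apply]
  rw [h2, LinearMap.det_comp, h]
  rfl

variable [MeasurableSpace E] [BorelSpace E] {μ : Measure E} [μ.IsAddHaarMeasure]

/-- The integral form of the fact that the degree of `Φ` on `U` is locally constant off
`Φ(∂U)`: the distribution `h ↦ ∫_U (h ∘ Φ) det DΦ` has zero derivatives there.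
The integrand, extended by zero off `U`, is almost everywhere the Jacobian determinant of the
compactly supported Lipschitz map obtained from `Φ`, cut off far away, by replacing its component
along `v` by `g ∘ Φ` on `U` and by `0` off `U`. -/
theorem LipschitzWith.setIntegral_fderiv_mul_det_fderiv_eq_zero {Φ : E → E} {K : ℝ≥0}
    (hΦ : LipschitzWith K Φ) {U : Set E} (hU : IsOpen U) (hUb : Bornology.IsBounded U)
    {g : E → ℝ} (hg : ContDiff ℝ 1 g) (hgc : HasCompactSupport g)
    (hgU : ∀ z ∈ frontier U, Φ z ∉ tsupport g) (v : E) :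
    ∫ x in U, fderiv ℝ g (Φ x) v * (fderiv ℝ Φ x).det ∂μ = 0 := by
  rcases eq_or_ne v 0 with rfl | hv
  · simp
  have : Nontrivial E := ⟨v, 0, hv⟩
  obtain ⟨l, hl⟩ := SeparatingDual.exists_eq_one (R := ℝ) hv
  obtain ⟨R, hRpos, hR⟩ := hUb.subset_ball_lt 0 (0 : E)
  obtain ⟨K₁, ψ, hψ, hψc, hψΦ⟩ := hΦ.exists_hasCompactSupport_eqOn_ball hRpos.le
  obtain ⟨K₂, hgL⟩ := hg.lipschitzWith_of_hasCompactSupport hgc one_ne_zero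
  let w : E → ℝ := U.indicator (g ∘ Φ)
  have hw : LipschitzWith (K₂ * K) w := (hgL.comp hΦ).indicator_of_frontier fun z hz =>
    image_eq_zero_of_notMem_tsupport (f := g) (hgU z hz)
  have hwU : ∀ x, x ∉ U → w =ᶠ[𝓝 x] 0 := by
    intro x hx
    by_cases hxf : x ∈ frontier U
    · have : ∀ᶠ y in 𝓝 x, Φ y ∈ (tsupport g)ᶜ :=
        hΦ.continuous.continuousAt.eventually
          ((isClosed_tsupport g).isOpen_compl.mem_nhds (hgU x hxf))
      filter_upwards [this] with y hy
      have : g (Φ y) = 0 := image_eq_zero_of_notMem_tsupport hy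
      simp [w, indicator, this]
    · have : x ∈ (closure U)ᶜ := fun h => hxf ⟨h, fun h' => hx (interior_subset h')⟩
      filter_upwards [isClosed_closure.isOpen_compl.mem_nhds this] with y hy
      exact indicator_of_notMem (fun h => hy (subset_closure h)) _
  let u : E → E := fun x => ψ x + (w x - l (ψ x)) • v
  have huL : LipschitzWith (K₁ + ‖v‖₊ * (K₂ * K + ‖l‖₊ * K₁)) u := by
    refine hψ.add ?_
    have h1 : LipschitzWith (K₂ * K + ‖l‖₊ * K₁) fun x => w x - l (ψ x) :=
      hw.sub (l.lipschitz.comp hψ)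
    have h2 : LipschitzWith ‖v‖₊ fun r : ℝ => r • v := by
      refine LipschitzWith.of_dist_le_mul fun a b => ?_
      rw [dist_eq_norm, ← sub_smul, norm_smul, mul_comm, dist_eq_norm]
      rfl
    exact h2.comp h1
  have huc : HasCompactSupport u := by
    have hwc : HasCompactSupport w := by
      refine HasCompactSupport.intro (isCompact_closedBall (0 : E) R) fun x hx => ?_
      exact indicator_of_notMem (fun h => hx (Metric.ball_subset_closedBall (hR h))) _
    exact hψc.add ((hwc.sub (hψc.comp_left (map_zero l))).smul_right)
  have hae : ∀ᵐ x ∂μ, (fderiv ℝ u x).det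
      = U.indicator (fun x => fderiv ℝ g (Φ x) v * (fderiv ℝ Φ x).det) x := by
    filter_upwards [hΦ.ae_differentiableAt, hψ.ae_differentiableAt] with x hxΦ hxψ
    by_cases hx : x ∈ U
    · rw [indicator_of_mem hx]
      have hloc : u =ᶠ[𝓝 x] fun y => Φ y + (g (Φ y) - l (Φ y)) • v := by
        filter_upwards [hU.mem_nhds hx] with y hy
        simp [u, w, hy, hψΦ (hR hy)]
      have hd : HasFDerivAt u (((ContinuousLinearMap.id ℝ E
          + (fderiv ℝ g (Φ x) - l).smulRight v)).comp (fderiv ℝ Φ x)) x := by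
        refine HasFDerivAt.congr_of_eventuallyEq ?_ hloc
        have hgx : HasFDerivAt g (fderiv ℝ g (Φ x)) (Φ x) :=
          (hg.differentiable one_ne_zero).differentiableAt.hasFDerivAt
        have h1 : HasFDerivAt (fun z => z + (g z - l z) • v) (ContinuousLinearMap.id ℝ E
          + (fderiv ℝ g (Φ x) - l).smulRight v) (Φ x) :=
          (hasFDerivAt_id _).add ((hgx.sub l.hasFDerivAt).smul_const v)
        exact h1.comp x hxΦ.hasFDerivAt
      rw [hd.fderiv, ContinuousLinearMap.det_id_add_smulRight_comp]
      simp [hl]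
    · rw [indicator_of_notMem hx]
      have hloc : u =ᶠ[𝓝 x] fun y => ψ y + (0 - l (ψ y)) • v := by
        filter_upwards [hwU x hx] with y hy
        simp [u, hy]
      have hd : HasFDerivAt u (((ContinuousLinearMap.id ℝ E
          + (0 - l).smulRight v)).comp (fderiv ℝ ψ x)) x := by
        refine HasFDerivAt.congr_of_eventuallyEq ?_ hloc
        have h1 : HasFDerivAt (fun z => z + (0 - l z) • v) (ContinuousLinearMap.id ℝ E
          + (0 - l).smulRight v) (ψ x) :=
          (hasFDerivAt_id _).add (((hasFDerivAt_const (0 : ℝ) _).sub l.hasFDerivAt).smul_const v)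
        exact h1.comp x hxψ.hasFDerivAt
      rw [hd.fderiv, ContinuousLinearMap.det_id_add_smulRight_comp]
      simp [hl]
  rw [← integral_indicator hU.measurableSet, ← integral_congr_ae hae]
  exact huL.integral_det_fderiv_eq_zero huc

end DegreeIntegral

/-! ### Distributions with zero derivatives -/

section ConstantDensity

open scoped Convolution

theorem integrable_comp_mul {E X : Type*} [TopologicalSpace E] [MeasurableSpace E] [BorelSpace E]
    [MeasurableSpace X] {ν : Measure X} {Φ : X → E} {j : X → ℝ} {C : ℝ} {h : E → ℝ}
    (hΦ : Measurable Φ) (hj : Integrable j ν) (hh : Continuous h) (hC : ∀ y, |h y| ≤ C) :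
    Integrable (fun x => h (Φ x) * j x) ν :=
  hj.bdd_mul (hh.measurable.comp hΦ).aestronglyMeasurable (Filter.Eventually.of_forall fun x =>
    hC (Φ x))

variable {E : Type*} [NormedAddCommGroup E] [InnerProductSpace ℝ E] [FiniteDimensional ℝ E]
  [MeasurableSpace E] [BorelSpace E]
  {X : Type*} [MeasurableSpace X] {ν : Measure X} {Φ : X → E} {j : X → ℝ} {V : Set E}

/-- If the distribution `h ↦ ∫ (h ∘ Φ) j` has zero derivatives on `V`, its mollification by a
kernel of radius at most `r` is constant on every ball of radius `r` concentric with a ball of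
radius `2r` contained in `V`. -/
theorem integral_mollifier_eq_const
    (hΦ : Measurable Φ) (hj : Integrable j ν)
    (H : ∀ g : E → ℝ, ContDiff ℝ 1 g → HasCompactSupport g → tsupport g ⊆ V → ∀ v,
      ∫ x, fderiv ℝ g (Φ x) v * j x ∂ν = 0)
    {a : E} {r : ℝ} (hV : Metric.closedBall a (2 * r) ⊆ V) {η : E → ℝ} (hη : ContDiff ℝ 1 η)
    (hηr : tsupport η ⊆ Metric.closedBall 0 r) {y : E} (hy : y ∈ Metric.ball a r) :
    ∫ x, η (Φ x - y) * j x ∂ν = ∫ x, η (Φ x - a) * j x ∂ν := by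
  have hηc : HasCompactSupport η :=
    (isCompact_closedBall 0 r).of_isClosed_subset (isClosed_tsupport η) hηr
  have hη' : Continuous (fderiv ℝ η) := hη.continuous_fderiv one_ne_zero
  obtain ⟨C, hC⟩ := hη.continuous.bounded_above_of_compact_support hηc
  obtain ⟨C', hC'⟩ := hη'.bounded_above_of_compact_support (hηc.fderiv ℝ)
  have hder : ∀ y ∈ Metric.ball a r,
      HasFDerivAt (fun y => ∫ x, η (Φ x - y) * j x ∂ν) (0 : E →L[ℝ] ℝ) y := by
    intro y hy
    have hm : ∀ y, Measurable fun x => Φ x - y := fun y => hΦ.sub_const y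
    have h1 : HasFDerivAt (fun y => ∫ x, η (Φ x - y) * j x ∂ν)
        (∫ x, (j x) • (-(fderiv ℝ η (Φ x - y))) ∂ν) y := by
      refine hasFDerivAt_integral_of_dominated_of_fderiv_le
        (F' := fun y x => (j x) • (-(fderiv ℝ η (Φ x - y))))
        (bound := fun x => |j x| * C') Filter.univ_mem ?_ ?_ ?_ ?_ ?_ ?_
      · exact Filter.Eventually.of_forall fun y =>
          (hη.continuous.measurable.comp (hm y)).aestronglyMeasurable.mul hj.1
      · exact integrable_comp_mul (hm y) hj hη.continuous hC
      · exact hj.1.smul (hη'.measurable.comp (hm y)).aestronglyMeasurable.neg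
      · refine Filter.Eventually.of_forall fun x y _ => ?_
        rw [norm_smul, norm_neg]
        exact mul_le_mul_of_nonneg_left (hC' _) (norm_nonneg _)
      · exact hj.abs.mul_const _
      · refine Filter.Eventually.of_forall fun x y _ => ?_
        have hd : HasFDerivAt η (fderiv ℝ η (Φ x - y)) (Φ x - y) :=
          (hη.differentiable one_ne_zero).differentiableAt.hasFDerivAt
        have h2 : HasFDerivAt (fun y => Φ x - y) (-ContinuousLinearMap.id ℝ E) y :=
          (hasFDerivAt_id y).const_sub _
        have h3 := (hd.comp y h2).mul_const (j x)
        have h4 : j x • -fderiv ℝ η (Φ x - y)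
            = j x • (fderiv ℝ η (Φ x - y)).comp (-ContinuousLinearMap.id ℝ E) := by
          ext v; simp
        rw [h4]
        exact h3
    have hint : Integrable (fun x => (j x) • (-(fderiv ℝ η (Φ x - y)))) ν := by
      refine (hj.abs.mul_const C').mono'
        (hj.1.smul (hη'.measurable.comp (hm y)).aestronglyMeasurable.neg)
        (Filter.Eventually.of_forall fun x => ?_)
      rw [norm_smul, norm_neg]
      exact mul_le_mul_of_nonneg_left (hC' _) (norm_nonneg _)
    convert h1 using 1
    ext v
    rw [ContinuousLinearMap.integral_apply hint]
    have hgs : tsupport (fun z => η (z - y)) ⊆ Metric.closedBall y r := by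
      refine closure_minimal (fun z hz => ?_) Metric.isClosed_closedBall
      have := hηr (subset_tsupport η (a := z - y) hz)
      simpa [dist_eq_norm] using this
    have h4 := H (fun z => η (z - y)) (hη.comp (contDiff_id.sub contDiff_const))
      ((isCompact_closedBall y r).of_isClosed_subset (isClosed_tsupport _) hgs)
      (hgs.trans ((Metric.closedBall_subset_closedBall' (by
        have := Metric.mem_ball.1 hy; linarith)).trans hV)) v
    simp only [fderiv_comp_sub] at h4
    have h5 : ∀ x, ((j x) • (-(fderiv ℝ η (Φ x - y)))) v
        = -(fderiv ℝ η (Φ x - y) v * j x) := fun x => by simp [mul_comm]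
    simp_rw [h5, integral_neg, h4]
    simp
  refine Metric.isOpen_ball.is_const_of_fderiv_eq_zero (𝕜 := ℝ)
    (convex_ball a r).isPreconnected
    (fun y hy => (hder y hy).differentiableAt.differentiableWithinAt)
    (fun y hy => (hder y hy).fderiv) hy
    (Metric.mem_ball_self (dist_nonneg.trans_lt (Metric.mem_ball.1 hy)))

variable {μ : Measure E} [μ.IsAddHaarMeasure] [IsFiniteMeasure ν]

/-- A distribution `h ↦ ∫ (h ∘ Φ) j` with zero derivatives on `V` is locally a multiple of the
Haar measure. -/
theorem exists_integral_comp_mul_eq_const_mul_on_ball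
    (hΦ : Measurable Φ) (hj : Integrable j ν)
    (H : ∀ g : E → ℝ, ContDiff ℝ 1 g → HasCompactSupport g → tsupport g ⊆ V → ∀ v,
      ∫ x, fderiv ℝ g (Φ x) v * j x ∂ν = 0)
    {a : E} {r : ℝ} (hr : 0 < r) (hV : Metric.closedBall a (2 * r) ⊆ V) :
    ∃ c : ℝ, ∀ h : E → ℝ, Continuous h → tsupport h ⊆ Metric.ball a r →
      ∫ x, h (Φ x) * j x ∂ν = c * ∫ y, h y ∂μ := by
  let b : ℕ → ContDiffBump (0 : E) := fun n =>
    ⟨r / (n + 2), r / (n + 1), by positivity, by gcongr; norm_num⟩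
  have hbout : ∀ n, (b n).rOut = r / (n + 1) := fun n => rfl
  have hbr : ∀ n, (b n).rOut ≤ r := fun n => by
    rw [hbout]; exact div_le_self hr.le (by linarith [Nat.cast_nonneg (α := ℝ) n])
  have hb0 : Filter.Tendsto (fun n => (b n).rOut) Filter.atTop (𝓝 0) :=
    tendsto_const_div_atTop_nhds_zero_nat r |>.comp (Filter.tendsto_add_atTop_nat 1) |>.congr
      fun n => by simp [hbout]
  let k : ℕ → ℝ := fun n => ∫ x, (b n).normed μ (Φ x - a) * j x ∂ν
  -- By Fubini, testing against the mollification of `h` multiplies `∫ h` by the constant value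
  -- `k n` of the mollified distribution.
  have key : ∀ h : E → ℝ, Continuous h → tsupport h ⊆ Metric.ball a r →
      Filter.Tendsto (fun n => k n * ∫ y, h y ∂μ) Filter.atTop (𝓝 (∫ x, h (Φ x) * j x ∂ν)) := by
    intro h hh hs
    have hhc : HasCompactSupport h :=
      (isCompact_closedBall a r).of_isClosed_subset (isClosed_tsupport h)
        (hs.trans Metric.ball_subset_closedBall)
    obtain ⟨C, hC⟩ := hh.bounded_above_of_compact_support hhc
    have hhint : Integrable h μ := hh.integrable_of_hasCompactSupport hhc
    have hk : ∀ n, k n * ∫ y, h y ∂μ =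
        ∫ x, ((b n).normed μ ⋆[ContinuousLinearMap.lsmul ℝ ℝ, μ] h) (Φ x) * j x ∂ν := by
      intro n
      set η := (b n).normed μ
      have hηc : Continuous η := (b n).continuous_normed
      obtain ⟨B, hB⟩ := hηc.bounded_above_of_compact_support (b n).hasCompactSupport_normed
      have hint : Integrable (Function.uncurry fun x y => η (Φ x - y) * (j x * h y))
          (ν.prod μ) := by
        refine (hj.mul_prod hhint).bdd_mul (c := B) ?_ (Filter.Eventually.of_forall fun z => hB _)
        exact (hηc.measurable.comp
          ((hΦ.comp measurable_fst).sub measurable_snd)).aestronglyMeasurable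
      calc k n * ∫ y, h y ∂μ = ∫ y, k n * h y ∂μ := (integral_const_mul _ _).symm
        _ = ∫ y, (∫ x, η (Φ x - y) * (j x * h y) ∂ν) ∂μ := by
            refine integral_congr_ae (Filter.Eventually.of_forall fun y => ?_)
            simp only [← mul_assoc, integral_mul_const]
            by_cases hy : y ∈ Metric.ball a r
            · rw [integral_mollifier_eq_const hΦ hj H hV ((b n).contDiff_normed (n := 1))
                (by rw [ContDiffBump.tsupport_normed_eq]
                    exact Metric.closedBall_subset_closedBall (hbr n)) hy]
            · rw [image_eq_zero_of_notMem_tsupport fun h' => hy (hs h'), mul_zero, mul_zero]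
        _ = ∫ x, (∫ y, η (Φ x - y) * (j x * h y) ∂μ) ∂ν := (integral_integral_swap hint).symm
        _ = _ := by
            refine integral_congr_ae (Filter.Eventually.of_forall fun x => ?_)
            simp only [convolution_eq_swap, ContinuousLinearMap.lsmul_apply, smul_eq_mul]
            rw [← integral_mul_const]
            refine integral_congr_ae (Filter.Eventually.of_forall fun y => ?_)
            simp only; ring
    simp_rw [hk]
    have hcont : ∀ n, Continuous ((b n).normed μ ⋆[ContinuousLinearMap.lsmul ℝ ℝ, μ] h) :=
      fun n => (b n).hasCompactSupport_normed.continuous_convolution_left _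
        (b n).continuous_normed hh.locallyIntegrable
    refine tendsto_integral_of_dominated_convergence (fun x => (2 * C + C) * |j x|)
      (fun n => ?_) (hj.abs.const_mul _) (fun n => ?_) ?_
    · exact ((hcont n).measurable.comp hΦ).aestronglyMeasurable.mul hj.1
    · refine Filter.Eventually.of_forall fun x => ?_
      rw [norm_mul]
      refine mul_le_mul_of_nonneg_right ?_ (norm_nonneg _)
      have h1 := ContDiffBump.dist_normed_convolution_le (φ := b n) (μ := μ) (x₀ := Φ x)
        (ε := 2 * C) hh.aestronglyMeasurable (fun y _ => by
          rw [dist_eq_norm]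
          exact (norm_sub_le _ _).trans (by linarith [hC y, hC (Φ x)]))
      rw [dist_eq_norm] at h1
      have h2 := norm_sub_norm_le
        (((b n).normed μ ⋆[ContinuousLinearMap.lsmul ℝ ℝ, μ] h) (Φ x)) (h (Φ x))
      linarith [hC (Φ x)]
    · refine Filter.Eventually.of_forall fun x => ?_
      exact (ContDiffBump.convolution_tendsto_right_of_continuous hb0 hh (Φ x)).mul_const _
  let b₀ : ContDiffBump a := ⟨r / 4, r / 2, by positivity, by linarith⟩
  have h0 := key (b₀.normed μ) b₀.continuous_normed (by
    rw [ContDiffBump.tsupport_normed_eq]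
    exact Metric.closedBall_subset_ball (half_lt_self hr))
  simp only [ContDiffBump.integral_normed, mul_one] at h0
  exact ⟨_, fun h hh hs => tendsto_nhds_unique (key h hh hs) (h0.mul_const _)⟩

/-- On a connected open set the local densities given by
`exists_integral_comp_mul_eq_const_mul_on_ball` agree. -/
theorem exists_integral_comp_mul_eq_const_mul
    (hΦ : Measurable Φ) (hj : Integrable j ν) (hVo : IsOpen V) (hVc : IsPreconnected V)
    (H : ∀ g : E → ℝ, ContDiff ℝ 1 g → HasCompactSupport g → tsupport g ⊆ V → ∀ v,
      ∫ x, fderiv ℝ g (Φ x) v * j x ∂ν = 0) :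
    ∃ c : ℝ, ∀ a ∈ V, ∃ r > 0, ∀ h : E → ℝ, Continuous h → tsupport h ⊆ Metric.ball a r →
      ∫ x, h (Φ x) * j x ∂ν = c * ∫ y, h y ∂μ := by
  let P : ℝ → E → ℝ → Prop := fun c a r => ∀ h : E → ℝ, Continuous h →
    tsupport h ⊆ Metric.ball a r → ∫ x, h (Φ x) * j x ∂ν = c * ∫ y, h y ∂μ
  have hex : ∀ a ∈ V, ∃ c, ∃ r > 0, P c a r := by
    intro a ha
    obtain ⟨ε, hε, hεV⟩ := Metric.nhds_basis_closedBall.mem_iff.1 (hVo.mem_nhds ha)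
    obtain ⟨c, hc⟩ := exists_integral_comp_mul_eq_const_mul_on_ball (μ := μ) hΦ hj H
      (half_pos hε) (by rwa [mul_div_cancel₀ ε two_ne_zero])
    exact ⟨c, ε / 2, half_pos hε, hc⟩
  have huniq : ∀ a c c', (∃ r > 0, P c a r) → (∃ r > 0, P c' a r) → c = c' := by
    rintro a c c' ⟨r, hr, h⟩ ⟨r', hr', h'⟩
    have hm : 0 < min r r' := lt_min hr hr'
    let b₀ : ContDiffBump a := ⟨min r r' / 4, min r r' / 2, by positivity, by linarith⟩
    have hs : tsupport (b₀.normed μ) ⊆ Metric.ball a (min r r') := by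
      rw [ContDiffBump.tsupport_normed_eq]
      exact Metric.closedBall_subset_ball (half_lt_self hm)
    have e1 := h _ b₀.continuous_normed (hs.trans (Metric.ball_subset_ball (min_le_left _ _)))
    have e2 := h' _ b₀.continuous_normed (hs.trans (Metric.ball_subset_ball (min_le_right _ _)))
    rw [e1] at e2
    simpa [ContDiffBump.integral_normed] using e2
  have hopen : ∀ s : Set ℝ, IsOpen {a | ∃ c ∈ s, ∃ r > 0, P c a r} := by
    intro s
    refine Metric.isOpen_iff.2 ?_
    rintro a ⟨c, hc, r, hr, h⟩
    refine ⟨r, hr, fun b hb => ⟨c, hc, r - dist b a, sub_pos.2 hb, fun g hg hgs => h g hg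
      (hgs.trans (Metric.ball_subset_ball' (by linarith)))⟩⟩
  rcases V.eq_empty_or_nonempty with rfl | ⟨a₀, ha₀⟩
  · exact ⟨0, fun a ha => ha.elim⟩
  obtain ⟨c₀, hc₀⟩ := hex a₀ ha₀
  refine ⟨c₀, fun a ha => ?_⟩
  obtain ⟨c, hc⟩ := hex a ha
  by_cases hcc : c = c₀
  · rwa [hcc] at hc
  obtain ⟨z, -, ⟨c₁, hc₁, h₁⟩, ⟨c₂, hc₂, h₂⟩⟩ := hVc _ _ (hopen {c₀}) (hopen {c₀}ᶜ)
    (fun z hz => by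
      obtain ⟨c', hc'⟩ := hex z hz
      by_cases h : c' = c₀
      · exact Or.inl ⟨c', h, hc'⟩
      · exact Or.inr ⟨c', h, hc'⟩)
    ⟨a₀, ha₀, c₀, rfl, hc₀⟩ ⟨a, ha, c, hcc, hc⟩
  exact absurd (huniq z c₂ c₁ h₂ h₁ ▸ hc₁) hc₂

end ConstantDensity

/-! ### Boundary charts -/

section Charts

variable {E F : Type*} [NormedAddCommGroup E] [NormedSpace ℝ E]

/-- A `C¹` chart of the ambient space near a boundary point `p` of `Ω` which straightens `Ω`: on
its source, `Ω` corresponds to the open half-space `{coord < 0}`. Differentiability is recorded at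
`p` only; `normal` is a vector transversal to the hyperplane `{coord = 0}`. -/
structure BoundaryChart (Ω : Set E) (p : E) where
  toFun : OpenPartialHomeomorph E E
  coord : E →L[ℝ] ℝ
  normal : E
  coord_normal : coord normal = 1
  mem_source : p ∈ toFun.source
  contDiffAt : ContDiffAt ℝ 1 toFun p
  contDiffAt_symm : ContDiffAt ℝ 1 toFun.symm (toFun p)
  mem_iff : ∀ x ∈ toFun.source, x ∈ Ω ↔ coord (toFun x) < 0

namespace BoundaryChart

variable {Ω : Set E} {p : E}

theorem isOpenMap_coord (A : BoundaryChart Ω p) : IsOpenMap A.coord := by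
  refine A.coord.isOpenMap_of_ne_zero fun h => ?_
  have := A.coord_normal
  rw [h] at this
  simp at this

theorem isImage (A : BoundaryChart Ω p) : A.toFun.IsImage Ω (A.coord ⁻¹' Iio 0) :=
  fun x hx => (A.mem_iff x hx).symm

theorem mem_closure_iff (A : BoundaryChart Ω p) {x : E} (hx : x ∈ A.toFun.source) :
    x ∈ closure Ω ↔ A.coord (A.toFun x) ≤ 0 := by
  have h := A.isImage.closure hx
  rw [← A.isOpenMap_coord.preimage_closure_eq_closure_preimage A.coord.continuous, closure_Iio] at h
  exact h.symm

theorem mem_frontier_iff (A : BoundaryChart Ω p) {x : E} (hx : x ∈ A.toFun.source) :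
    x ∈ frontier Ω ↔ A.coord (A.toFun x) = 0 := by
  have h := A.isImage.frontier hx
  rw [← A.isOpenMap_coord.preimage_frontier_eq_frontier_preimage A.coord.continuous,
    frontier_Iio] at h
  exact h.symm

theorem mem_closure_compl_closure (A : BoundaryChart Ω p) (hp : p ∈ frontier Ω) :
    p ∈ closure (closure Ω)ᶜ := by
  have h := A.isImage.closure.compl.closure A.mem_source
  rw [← A.isOpenMap_coord.preimage_closure_eq_closure_preimage A.coord.continuous, closure_Iio,
    ← preimage_compl, compl_Iic,
    ← A.isOpenMap_coord.preimage_closure_eq_closure_preimage A.coord.continuous, closure_Ioi] at h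
  exact h.1 ((A.mem_frontier_iff A.mem_source).1 hp).ge

theorem exists_lipschitzOnWith_closure (A : BoundaryChart Ω p) [NormedAddCommGroup F]
    [NormedSpace ℝ F] {φ : E → F}
    (hφ : ContDiffWithinAt ℝ 1 φ (closure Ω) p) (hp : p ∈ frontier Ω) :
    ∃ K, ∃ t ∈ 𝓝[closure Ω] p, LipschitzOnWith K φ t := by
  set s : Set E := {z | A.coord z ≤ 0}
  have hAp : A.toFun p ∈ s := ((A.mem_frontier_iff A.mem_source).1 hp).le
  have htn : A.toFun.target ∈ 𝓝 (A.toFun p) :=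
    A.toFun.open_target.mem_nhds (A.toFun.map_source A.mem_source)
  have hg : ContDiffWithinAt ℝ 1 (φ ∘ A.toFun.symm) s (A.toFun p) := by
    rw [← contDiffWithinAt_inter htn]
    refine ContDiffWithinAt.comp (t := closure Ω) _ ?_ A.contDiffAt_symm.contDiffWithinAt ?_
    · rwa [A.toFun.left_inv A.mem_source]
    · rintro z ⟨hz, hzt⟩
      refine (A.mem_closure_iff (A.toFun.map_target hzt)).2 ?_
      rwa [A.toFun.right_inv hzt]
  obtain ⟨K, t, ht, hK⟩ := hg.exists_lipschitzOnWith
    (convex_halfSpace_le A.coord.toLinearMap.isLinear 0)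
  obtain ⟨K', t', ht', hK'⟩ := A.contDiffAt.exists_lipschitzOnWith
  have hsrc : A.toFun.source ∈ 𝓝 p := A.toFun.open_source.mem_nhds A.mem_source
  have htend : Filter.Tendsto A.toFun (𝓝[closure Ω] p) (𝓝[s] (A.toFun p)) := by
    refine tendsto_nhdsWithin_iff.2 ⟨A.contDiffAt.continuousAt.mono_left nhdsWithin_le_nhds, ?_⟩
    filter_upwards [self_mem_nhdsWithin, mem_nhdsWithin_of_mem_nhds hsrc] with x hx hxs
    exact (A.mem_closure_iff hxs).1 hx
  refine ⟨K * K', (t' ∩ A.toFun.source) ∩ A.toFun ⁻¹' t, Filter.inter_mem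
    (mem_nhdsWithin_of_mem_nhds (Filter.inter_mem ht' hsrc)) (htend ht), ?_⟩
  have h := hK.comp (hK'.mono (fun x hx => hx.1.1 : (t' ∩ A.toFun.source) ∩ A.toFun ⁻¹' t ⊆ t'))
    (fun x hx => hx.2)
  intro x hx y hy
  have := h hx hy
  simpa only [Function.comp, A.toFun.left_inv hx.1.2, A.toFun.left_inv hy.1.2] using this

variable [FiniteDimensional ℝ E] [MeasurableSpace E] [BorelSpace E] {μ : Measure E}
  [μ.IsAddHaarMeasure]

theorem exists_addHaar_frontier_inter_eq_zero (A : BoundaryChart Ω p) :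
    ∃ t ∈ 𝓝 p, μ (frontier Ω ∩ t) = 0 := by
  obtain ⟨K, t, ht, hK⟩ := A.contDiffAt_symm.exists_lipschitzOnWith
  obtain ⟨g, hg, hgt⟩ := hK.extend_finite_dimension
  have hker : μ (LinearMap.ker (A.coord : E →ₗ[ℝ] ℝ) : Set E) = 0 := by
    refine Measure.addHaar_submodule μ _ fun h => ?_
    have : A.normal ∈ LinearMap.ker (A.coord : E →ₗ[ℝ] ℝ) := h ▸ Submodule.mem_top
    have h0 : A.coord A.normal = 0 := this
    rw [A.coord_normal] at h0
    exact one_ne_zero h0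
  refine ⟨A.toFun.source ∩ A.toFun ⁻¹' t, Filter.inter_mem
    (A.toFun.open_source.mem_nhds A.mem_source) (A.contDiffAt.continuousAt ht),
    measure_mono_null ?_ (hg.addHaar_image_eq_zero hker)⟩
  rintro x ⟨hx, hxs, hxt⟩
  exact ⟨A.toFun x, (A.mem_frontier_iff hxs).1 hx, by
    rw [← hgt hxt, A.toFun.left_inv hxs]⟩

end BoundaryChart

end Charts

theorem HasC1Boundary.nonempty_boundaryChart {m : ℕ} {Ω : Set (Euc m)} (h : HasC1Boundary Ω)
    {p : Euc m} (hp : p ∈ frontier Ω) : Nonempty (BoundaryChart Ω p) := by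
  obtain ⟨W, ρ, hW, hpW, hρ, hρp, hdρ, hΩ⟩ := h p hp
  set l := fderiv ℝ ρ p with hl
  obtain ⟨v, hv⟩ : ∃ v, l v ≠ 0 := by
    by_contra! h0
    exact hdρ (ContinuousLinearMap.ext h0)
  set e := (l v)⁻¹ • v with he
  have hle : l e = 1 := by rw [he, map_smul, smul_eq_mul, inv_mul_cancel₀ hv]
  have hρA : ContDiffAt ℝ 1 ρ p := hρ.contDiffAt (hW.mem_nhds hpW)
  -- `f` replaces the coordinate `l` by `ρ`, and its derivative at `p` is the identity.
  let f : Euc m → Euc m := fun x => x + (ρ x - l x) • e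
  have hf : ContDiffAt ℝ 1 f p :=
    contDiffAt_id.add ((hρA.sub l.contDiff.contDiffAt).smul contDiffAt_const)
  have hf' : HasFDerivAt f ((ContinuousLinearEquiv.refl ℝ (Euc m) : Euc m ≃L[ℝ] Euc m) :
      Euc m →L[ℝ] Euc m) p := by
    have h1 : HasFDerivAt ρ l p := (hρA.differentiableAt one_ne_zero).hasFDerivAt
    have h2 := (hasFDerivAt_id p).add ((h1.sub l.hasFDerivAt).smul_const e)
    rw [sub_self] at h2
    have h3 : ((ContinuousLinearEquiv.refl ℝ (Euc m) : Euc m ≃L[ℝ] Euc m) : Euc m →L[ℝ] Euc m)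
        = ContinuousLinearMap.id ℝ (Euc m) + (0 : Euc m →L[ℝ] ℝ).smulRight e := by
      ext x; simp
    rw [h3]
    exact h2
  let A := hf.toOpenPartialHomeomorph f hf' one_ne_zero
  have hA : ∀ x, A x = f x := fun x => rfl
  have hpA : p ∈ A.source := hf.mem_toOpenPartialHomeomorph_source hf' one_ne_zero
  have hlf : ∀ x, l (f x) = ρ x := fun x => by simp [f, hle]
  refine ⟨⟨A.restrOpen W hW, l, e, hle, ⟨hpA, hpW⟩, hf, ?_, ?_⟩⟩
  · exact hf.to_localInverse hf' one_ne_zero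
  · intro x hx
    have hx2 : x ∈ W := hx.2
    change x ∈ Ω ↔ l (f x) < 0
    rw [hlf]
    constructor
    · intro h
      have : x ∈ Ω ∩ W := ⟨h, hx2⟩
      rw [hΩ] at this
      exact this.2
    · intro h
      have : x ∈ {x | x ∈ W ∧ ρ x < 0} := ⟨hx2, h⟩
      rw [← hΩ] at this
      exact this.1

theorem HasC1Boundary.volume_frontier {m : ℕ} {Ω : Set (Euc m)} (h : HasC1Boundary Ω) :
    volume (frontier Ω) = 0 := by
  refine measure_null_of_locally_null _ fun p hp => ?_
  obtain ⟨A⟩ := h.nonempty_boundaryChart hp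
  obtain ⟨t, ht, ht0⟩ := A.exists_addHaar_frontier_inter_eq_zero (μ := volume)
  exact ⟨_, inter_mem_nhdsWithin _ ht, ht0⟩

/-- In a boundary chart the closure of the domain is convex, so that a `C¹` map on it is locally
Lipschitz; by compactness it is Lipschitz. -/
theorem HasC1Boundary.exists_lipschitzOnWith {m : ℕ} {Ω : Set (Euc m)} (h : HasC1Boundary Ω)
    (ho : IsOpen Ω) (hb : Bornology.IsBounded Ω) {φ : Euc m → Euc m}
    (hφ : ContDiffOn ℝ 1 φ (closure Ω)) : ∃ K, LipschitzOnWith K φ (closure Ω) := by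
  refine LocallyLipschitzOn.exists_lipschitzOnWith_of_compact hb.isCompact_closure fun x hx => ?_
  by_cases hxf : x ∈ frontier Ω
  · obtain ⟨A⟩ := h.nonempty_boundaryChart hxf
    exact A.exists_lipschitzOnWith_closure (hφ x hx) hxf
  · have hxΩ : x ∈ Ω := by
      by_contra hx'
      exact hxf (ho.frontier_eq ▸ ⟨hx, hx'⟩)
    obtain ⟨K, t, ht, hK⟩ := ((hφ x hx).contDiffAt
      (Filter.mem_of_superset (ho.mem_nhds hxΩ) subset_closure)).exists_lipschitzOnWith
    exact ⟨K, t, mem_nhdsWithin_of_mem_nhds ht, hK⟩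

/-! ### Extension of a boundary map across the boundary -/

section Extension

open Filter

/-- `f` is Lipschitz on some neighbourhood of `x`. -/
def LipschitzNear {α β : Type*} [PseudoEMetricSpace α] [PseudoEMetricSpace β] (f : α → β)
    (x : α) : Prop :=
  ∃ K, ∃ t ∈ 𝓝 x, LipschitzOnWith K f t

theorem LipschitzNear.comp {α β γ : Type*} [PseudoEMetricSpace α] [PseudoEMetricSpace β]
    [PseudoEMetricSpace γ] {g : β → γ} {f : α → β} {x : α} (hg : LipschitzNear g (f x))
    (hf : LipschitzNear f x) : LipschitzNear (g ∘ f) x := by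
  obtain ⟨K, t, ht, hK⟩ := hg
  obtain ⟨K', t', ht', hK'⟩ := hf
  have hc : ContinuousAt f x := hK'.continuousOn.continuousAt ht'
  exact ⟨K * K', t' ∩ f ⁻¹' t, inter_mem ht' (hc ht),
    hK.comp (hK'.mono inter_subset_left) fun x hx => hx.2⟩

theorem LipschitzNear.continuousAt {α β : Type*} [PseudoEMetricSpace α] [PseudoEMetricSpace β]
    {f : α → β} {x : α} (hf : LipschitzNear f x) : ContinuousAt f x := by
  obtain ⟨K, t, ht, hK⟩ := hf
  exact hK.continuousOn.continuousAt ht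

theorem LipschitzNear.add {α β : Type*} [PseudoEMetricSpace α] [SeminormedAddCommGroup β]
    {f g : α → β} {x : α} (hf : LipschitzNear f x) (hg : LipschitzNear g x) :
    LipschitzNear (fun y => f y + g y) x := by
  obtain ⟨K, t, ht, hK⟩ := hf
  obtain ⟨K', t', ht', hK'⟩ := hg
  exact ⟨K + K', t ∩ t', inter_mem ht ht',
    (hK.mono inter_subset_left).add (hK'.mono inter_subset_right)⟩

namespace BoundaryChart

variable {E : Type*} [NormedAddCommGroup E] [NormedSpace ℝ E] {Ω D : Set E} {p q : E}

/-- The projection onto the hyperplane `{coord = 0}` along `normal`. -/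
def proj (A : BoundaryChart Ω p) : E →L[ℝ] E :=
  ContinuousLinearMap.id ℝ E - A.coord.smulRight A.normal

theorem proj_apply (A : BoundaryChart Ω p) (z : E) : A.proj z = z - A.coord z • A.normal := rfl

theorem coord_proj (A : BoundaryChart Ω p) (z : E) : A.coord (A.proj z) = 0 := by
  simp [proj_apply, A.coord_normal]

theorem proj_of_coord_eq_zero (A : BoundaryChart Ω p) {z : E} (hz : A.coord z = 0) :
    A.proj z = z := by
  simp [proj_apply, hz]

/-- The extension of a map between boundaries to a neighbourhood of `p`: in the charts `A`, `B` it
acts on the hyperplanes as the given map, and it preserves the transversal coordinate. -/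
def extend (A : BoundaryChart Ω p) (B : BoundaryChart D q) (Φ : E → E) (x : E) : E :=
  B.toFun.symm (B.toFun (Φ (A.toFun.symm (A.proj (A.toFun x)))) +
    A.coord (A.toFun x) • B.normal)

theorem proj_toFun_self (A : BoundaryChart Ω p) (hp : p ∈ frontier Ω) :
    A.proj (A.toFun p) = A.toFun p :=
  A.proj_of_coord_eq_zero ((A.mem_frontier_iff A.mem_source).1 hp)

theorem lipschitzNear_proj_toFun (A : BoundaryChart Ω p) (hp : p ∈ frontier Ω) :
    LipschitzNear (fun x => A.toFun.symm (A.proj (A.toFun x))) p := by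
  have h1 : LipschitzNear A.toFun p := A.contDiffAt.exists_lipschitzOnWith
  have h2 : LipschitzNear (fun x => A.proj (A.toFun x)) p :=
    LipschitzNear.comp ⟨_, univ, univ_mem, A.proj.lipschitz.lipschitzOnWith⟩ h1
  have h3 : LipschitzNear A.toFun.symm (A.proj (A.toFun p)) := by
    rw [A.proj_toFun_self hp]
    exact A.contDiffAt_symm.exists_lipschitzOnWith
  exact LipschitzNear.comp h3 h2

theorem lipschitzNear_extend_coord (A : BoundaryChart Ω p) (B : BoundaryChart D q)
    (hp : p ∈ frontier Ω) {Φ : E → E} (hΦ : LipschitzNear Φ p) (hpq : Φ p = q) :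
    LipschitzNear (fun x => B.toFun (Φ (A.toFun.symm (A.proj (A.toFun x)))) +
      A.coord (A.toFun x) • B.normal) p := by
  have hself : A.toFun.symm (A.proj (A.toFun p)) = p := by
    rw [A.proj_toFun_self hp, A.toFun.left_inv A.mem_source]
  have h1 : LipschitzNear A.toFun p := A.contDiffAt.exists_lipschitzOnWith
  have h2 : LipschitzNear (fun x => Φ (A.toFun.symm (A.proj (A.toFun x)))) p :=
    LipschitzNear.comp (by rwa [hself]) (A.lipschitzNear_proj_toFun hp)
  have h3 : LipschitzNear (fun x => B.toFun (Φ (A.toFun.symm (A.proj (A.toFun x))))) p := by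
    refine LipschitzNear.comp ?_ h2
    rw [hself, hpq]
    exact B.contDiffAt.exists_lipschitzOnWith
  refine h3.add ?_
  exact LipschitzNear.comp ⟨_, univ, univ_mem,
    (A.coord.smulRight B.normal).lipschitz.lipschitzOnWith⟩ h1

/-- Near `p`, the extension maps the outside of `Ω` injectively to the outside of `D`, and it
covers all points outside `D` near `q`. -/
theorem exists_extend (A : BoundaryChart Ω p) (B : BoundaryChart D q)
    (hp : p ∈ frontier Ω) {Φ ψ : E → E} (hΦ : LipschitzNear Φ p) (hpq : Φ p = q)
    (hΦm : MapsTo Φ (frontier Ω) (frontier D)) (hψm : MapsTo ψ (frontier D) (frontier Ω))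
    (hψ : ContinuousWithinAt ψ (frontier D) q) (hinv : InvOn ψ Φ (frontier Ω) (frontier D)) :
    ∃ (K : NNReal) (s : ℝ), 0 < s ∧ LipschitzOnWith K (A.extend B Φ) (Metric.ball p s) ∧
      (∀ x ∈ Metric.ball p s, x ∈ frontier Ω → A.extend B Φ x = Φ x) ∧
      (∀ x ∈ Metric.ball p s, x ∉ closure Ω → A.extend B Φ x ∉ closure D) ∧
      InjOn (A.extend B Φ) (Metric.ball p s \ closure Ω) ∧
      ∀ s' > 0, ∃ r > 0,
        Metric.ball q r \ closure D ⊆ A.extend B Φ '' (Metric.ball p s' \ closure Ω) := by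
  have hq : q ∈ frontier D := hpq ▸ hΦm hp
  have hself : A.toFun.symm (A.proj (A.toFun p)) = p := by
    rw [A.proj_toFun_self hp, A.toFun.left_inv A.mem_source]
  have hselfB : B.toFun.symm (B.proj (B.toFun q)) = q := by
    rw [B.proj_toFun_self hq, B.toFun.left_inv B.mem_source]
  have hA0 : A.coord (A.toFun p) = 0 := (A.mem_frontier_iff A.mem_source).1 hp
  have hB0 : B.coord (B.toFun q) = 0 := (B.mem_frontier_iff B.mem_source).1 hq
  have haux := A.lipschitzNear_extend_coord B hp hΦ hpq
  have hval : B.toFun (Φ (A.toFun.symm (A.proj (A.toFun p)))) + A.coord (A.toFun p) • B.normal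
      = B.toFun q := by rw [hself, hpq, hA0, zero_smul, add_zero]
  have hLip : LipschitzNear (A.extend B Φ) p := by
    refine LipschitzNear.comp ?_ haux
    rw [hval]
    exact B.contDiffAt_symm.exists_lipschitzOnWith
  obtain ⟨K, t, ht, hK⟩ := hLip
  have e1 : ∀ᶠ x in 𝓝 p, x ∈ A.toFun.source := A.toFun.open_source.mem_nhds A.mem_source
  have e2 : ∀ᶠ x in 𝓝 p, A.proj (A.toFun x) ∈ A.toFun.target := by
    refine (A.proj.continuous.continuousAt.comp A.contDiffAt.continuousAt).eventually ?_
    refine A.toFun.open_target.mem_nhds ?_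
    change A.proj (A.toFun p) ∈ _
    rw [A.proj_toFun_self hp]
    exact A.toFun.map_source A.mem_source
  have e3 : ∀ᶠ x in 𝓝 p, Φ (A.toFun.symm (A.proj (A.toFun x))) ∈ B.toFun.source := by
    refine (LipschitzNear.comp (g := Φ) (by rwa [hself])
      (A.lipschitzNear_proj_toFun hp)).continuousAt.eventually ?_
    refine B.toFun.open_source.mem_nhds ?_
    rw [Function.comp, hself, hpq]
    exact B.mem_source
  have e4 : ∀ᶠ x in 𝓝 p, B.toFun (Φ (A.toFun.symm (A.proj (A.toFun x)))) +
      A.coord (A.toFun x) • B.normal ∈ B.toFun.target := by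
    refine haux.continuousAt.eventually (B.toFun.open_target.mem_nhds ?_)
    beta_reduce
    rw [hval]
    exact B.toFun.map_source B.mem_source
  obtain ⟨s, hs, hsb⟩ := Metric.eventually_nhds_iff_ball.1
    ((eventually_mem_set.2 ht).and (e1.and (e2.and (e3.and e4))))
  have hfr : ∀ x ∈ Metric.ball p s,
      A.toFun.symm (A.proj (A.toFun x)) ∈ frontier Ω := by
    intro x hx
    obtain ⟨-, -, h2, -, -⟩ := hsb x hx
    rw [A.mem_frontier_iff (A.toFun.map_target h2), A.toFun.right_inv h2, A.coord_proj]
  have hcoord0 : ∀ x ∈ Metric.ball p s,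
      B.coord (B.toFun (Φ (A.toFun.symm (A.proj (A.toFun x))))) = 0 := by
    intro x hx
    obtain ⟨-, -, -, h3, -⟩ := hsb x hx
    exact (B.mem_frontier_iff h3).1 (hΦm (hfr x hx))
  -- The extension preserves the transversal coordinate.
  have hcoord : ∀ x ∈ Metric.ball p s,
      B.coord (B.toFun (A.extend B Φ x)) = A.coord (A.toFun x) := by
    intro x hx
    obtain ⟨-, -, -, -, h4⟩ := hsb x hx
    rw [extend, B.toFun.right_inv h4, map_add, hcoord0 x hx, map_smul, B.coord_normal]
    simp
  refine ⟨K, s, hs, hK.mono fun x hx => (hsb x hx).1, ?_, ?_, ?_, ?_⟩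
  · intro x hx hxf
    obtain ⟨-, h1, h2, h3, h4⟩ := hsb x hx
    have h0 := (A.mem_frontier_iff h1).1 hxf
    rw [extend, h0, zero_smul, add_zero, A.proj_of_coord_eq_zero h0, A.toFun.left_inv h1]
    rw [A.proj_of_coord_eq_zero h0, A.toFun.left_inv h1] at h3
    exact B.toFun.left_inv h3
  · intro x hx hxc
    obtain ⟨-, h1, h2, h3, h4⟩ := hsb x hx
    rw [A.mem_closure_iff h1] at hxc
    have h5 : A.extend B Φ x ∈ B.toFun.source := B.toFun.map_target h4
    rwa [B.mem_closure_iff h5, hcoord x hx]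
  · rintro x ⟨hx, -⟩ y ⟨hy, -⟩ hxy
    obtain ⟨-, h1, h2, h3, h4⟩ := hsb x hx
    obtain ⟨-, h1', h2', h3', h4'⟩ := hsb y hy
    have hc : A.coord (A.toFun x) = A.coord (A.toFun y) := by
      rw [← hcoord x hx, ← hcoord y hy, hxy]
    have h5 := B.toFun.symm.injOn h4 h4' hxy
    rw [hc] at h5
    have h6 := hinv.1.injOn (hfr x hx) (hfr y hy) (B.toFun.injOn h3 h3' (add_right_cancel h5))
    have h7 := A.toFun.symm.injOn h2 h2' h6
    rw [A.proj_apply, A.proj_apply, hc] at h7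
    exact A.toFun.injOn h1 h1' (sub_left_injective h7)
  · -- The inverse is the same construction applied to `ψ`, with the two charts exchanged.
    intro s' hs'
    let y₀ : E → E := fun y => B.toFun.symm (B.proj (B.toFun y))
    have f1 : ∀ᶠ y in 𝓝 q, y ∈ B.toFun.source := B.toFun.open_source.mem_nhds B.mem_source
    have f2 : ∀ᶠ y in 𝓝 q, B.proj (B.toFun y) ∈ B.toFun.target := by
      refine (B.proj.continuous.continuousAt.comp B.contDiffAt.continuousAt).eventually ?_
      refine B.toFun.open_target.mem_nhds ?_
      change B.proj (B.toFun q) ∈ _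
      rw [B.proj_toFun_self hq]
      exact B.toFun.map_source B.mem_source
    have hy₀ : Tendsto y₀ (𝓝 q) (𝓝[frontier D] q) := by
      refine tendsto_nhdsWithin_iff.2 ⟨?_, ?_⟩
      · have := (B.lipschitzNear_proj_toFun hq).continuousAt.tendsto
        rwa [hselfB] at this
      · filter_upwards [f2] with y hy
        rw [B.mem_frontier_iff (B.toFun.map_target hy), B.toFun.right_inv hy, B.coord_proj]
    have hψp : ψ q = p := by rw [← hpq]; exact hinv.1 hp
    have hψy : Tendsto (fun y => ψ (y₀ y)) (𝓝 q) (𝓝 p) := by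
      have := hψ.tendsto.comp hy₀
      rwa [hψp] at this
    have hAψ : Tendsto (fun y => A.toFun (ψ (y₀ y)) + B.coord (B.toFun y) • A.normal) (𝓝 q)
        (𝓝 (A.toFun p)) := by
      have h1 := A.contDiffAt.continuousAt.tendsto.comp hψy
      have h2 : Tendsto (fun y => B.coord (B.toFun y) • A.normal) (𝓝 q)
          (𝓝 ((0 : ℝ) • A.normal)) := by
        rw [← hB0]
        exact ((B.coord.continuous.continuousAt.comp
          B.contDiffAt.continuousAt).tendsto).smul_const _
      simpa using h1.add h2
    have f3 : ∀ᶠ y in 𝓝 q, ψ (y₀ y) ∈ A.toFun.source := hψy.eventually e1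
    have f4 : ∀ᶠ y in 𝓝 q,
        A.toFun (ψ (y₀ y)) + B.coord (B.toFun y) • A.normal ∈ A.toFun.target :=
      hAψ.eventually (A.toFun.open_target.mem_nhds (A.toFun.map_source A.mem_source))
    have f5 : ∀ᶠ y in 𝓝 q, A.toFun.symm (A.toFun (ψ (y₀ y)) + B.coord (B.toFun y) • A.normal)
        ∈ Metric.ball p s' := by
      have h1 := A.contDiffAt_symm.continuousAt.tendsto.comp hAψ
      rw [A.toFun.left_inv A.mem_source] at h1
      exact h1.eventually (Metric.ball_mem_nhds p hs')
    have f6 : ∀ᶠ y in 𝓝 q, y₀ y ∈ B.toFun.source := by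
      refine (hy₀.mono_right nhdsWithin_le_nhds).eventually f1
    obtain ⟨r, hr, hrb⟩ := Metric.eventually_nhds_iff_ball.1
      (f1.and (f2.and (f3.and (f4.and (f5.and (f6.and
        (hy₀.eventually self_mem_nhdsWithin)))))))
    refine ⟨r, hr, ?_⟩
    rintro y ⟨hy, hyD⟩
    obtain ⟨g1, g2, g3, g4, g5, g6, g7⟩ := hrb y hy
    have hψ0 : A.coord (A.toFun (ψ (y₀ y))) = 0 := (A.mem_frontier_iff g3).1 (hψm g7)
    refine ⟨_, ⟨g5, ?_⟩, ?_⟩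
    · rw [A.mem_closure_iff (A.toFun.map_target g4), A.toFun.right_inv g4, map_add, hψ0,
        map_smul, A.coord_normal, smul_eq_mul, mul_one, zero_add]
      rwa [B.mem_closure_iff g1] at hyD
    · have hproj : A.proj (A.toFun (ψ (y₀ y)) + B.coord (B.toFun y) • A.normal)
          = A.toFun (ψ (y₀ y)) := by
        rw [map_add, A.proj_of_coord_eq_zero hψ0, map_smul, A.proj_apply, A.coord_normal,
          one_smul, sub_self, smul_zero, add_zero]
      rw [extend, A.toFun.right_inv g4, hproj, A.toFun.left_inv g3, hinv.2 g7, map_add, hψ0,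
        map_smul, A.coord_normal, smul_eq_mul, mul_one, zero_add, B.toFun.right_inv g2,
        B.proj_apply, sub_add_cancel, B.toFun.left_inv g1]

end BoundaryChart

end Extension

/-! ### Maps of degree one or minus one -/

section Degree

open scoped NNReal

/-- Gluing two Lipschitz maps along the frontier of `Ω` inside a ball, and extending the result to
the whole space. -/
theorem LipschitzWith.exists_glue {E : Type*} [NormedAddCommGroup E] [NormedSpace ℝ E]
    [FiniteDimensional ℝ E] {Ω : Set E} {p : E} (hp : p ∈ frontier Ω) {Φ₀ Φ₁ : E → E} {K₀ K₁ : ℝ≥0}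
    {s : ℝ} (hs : 0 < s) (h₀ : LipschitzWith K₀ Φ₀)
    (h₁ : LipschitzOnWith K₁ Φ₁ (Metric.ball p (2 * s)))
    (heq : ∀ x ∈ Metric.ball p (2 * s), x ∈ frontier Ω → Φ₁ x = Φ₀ x) :
    ∃ (K : ℝ≥0) (Φ : E → E), LipschitzWith K Φ ∧ EqOn Φ Φ₀ (closure Ω) ∧
      EqOn Φ Φ₁ (Metric.closedBall p s \ closure Ω) := by
  classical
  set Ψ : E → E := (closure Ω).piecewise Φ₀ Φ₁
  have hΨ₀ : ∀ x ∈ closure Ω, Ψ x = Φ₀ x := fun x hx => piecewise_eq_of_mem _ _ _ hx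
  have hΨ₁ : ∀ x ∉ closure Ω, Ψ x = Φ₁ x := fun x hx => piecewise_eq_of_notMem _ _ _ hx
  have hin : Metric.closedBall p s ⊆ Metric.ball p (2 * s) :=
    Metric.closedBall_subset_ball (by linarith)
  have key : ∀ x ∈ closure Ω, ∀ y ∈ Metric.closedBall p s \ closure Ω,
      dist (Ψ x) (Ψ y) ≤ (2 * K₀ + K₁ : ℝ≥0) * dist x y := by
    rintro x hx y ⟨hys, hy⟩
    have hK₀ : (0 : ℝ) ≤ K₀ := K₀.2
    have hK₁ : (0 : ℝ) ≤ K₁ := K₁.2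
    rw [hΨ₀ _ hx, hΨ₁ _ hy]
    push_cast
    have through : ∀ z ∈ Metric.ball p (2 * s), z ∈ frontier Ω →
        dist (Φ₀ x) (Φ₁ y) ≤ K₀ * dist x z + K₁ * dist z y := fun z hz hzf =>
      (dist_triangle _ (Φ₀ z) _).trans (add_le_add (h₀.dist_le_mul x z) (by
        rw [← heq z hz hzf]; exact h₁.dist_le_mul z hz y (hin hys)))
    -- Near `p` the segment from `x` to `y` meets the frontier in the ball; a point `x` far from `p`
    -- is at distance at least `s` from `y`, and `p` serves as the intermediate point.
    by_cases hxb : x ∈ Metric.ball p (2 * s)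
    · obtain ⟨z, hz, hzs, hd⟩ := exists_mem_frontier_dist_add_dist_eq hx hy
      have h := through z ((convex_ball p (2 * s)).segment_subset hxb (hin hys) hzs)
        (frontier_closure_subset hz)
      have h1 : dist x z ≤ dist x y := hd ▸ le_add_of_nonneg_right dist_nonneg
      have h2 : dist z y ≤ dist x y := hd ▸ le_add_of_nonneg_left dist_nonneg
      nlinarith [dist_nonneg (x := x) (y := y)]
    · have h := through p (Metric.mem_ball_self (by positivity)) hp
      have h1 : 2 * s ≤ dist x p := not_lt.1 hxb
      have h2 : dist y p ≤ s := hys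
      have h3 := dist_triangle x y p
      rw [dist_comm p y] at h
      nlinarith
  have hΨ : LipschitzOnWith (2 * K₀ + K₁) Ψ (closure Ω ∪ Metric.closedBall p s) := by
    refine LipschitzOnWith.of_dist_le_mul fun x hx y hy => ?_
    by_cases hxc : x ∈ closure Ω <;> by_cases hyc : y ∈ closure Ω
    · rw [hΨ₀ _ hxc, hΨ₀ _ hyc]
      refine (h₀.dist_le_mul x y).trans ?_
      gcongr
      rw [two_mul, add_assoc]
      exact le_self_add
    · exact key x hxc y ⟨hy.resolve_left hyc, hyc⟩
    · rw [dist_comm, dist_comm x]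
      exact key y hyc x ⟨hx.resolve_left hxc, hxc⟩
    · rw [hΨ₁ _ hxc, hΨ₁ _ hyc]
      refine (h₁.dist_le_mul x (hin (hx.resolve_left hxc)) y (hin (hy.resolve_left hyc))).trans ?_
      gcongr
      exact le_add_self
  obtain ⟨Φ, hΦ, hΦΨ⟩ := hΨ.extend_finite_dimension
  refine ⟨_, Φ, hΦ, fun x hx => ?_, fun x hx => ?_⟩
  · rw [← hΦΨ (Or.inl hx)]
    exact hΨ₀ x hx
  · rw [← hΦΨ (Or.inr hx.1)]
    exact hΨ₁ x hx.2

/-- If a connected open set `V` does not meet `Φ(∂U)`, and some nonempty open part `G` of `V` is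
covered exactly once by `Φ` on `U`, then `Φ` has degree `±1` over `V`, in the sense that
`∫_U (h ∘ Φ) det DΦ = ± ∫ h` for all continuous `h` with small support in `V`. -/
theorem LipschitzWith.exists_degree_eq_one_or_neg_one {E : Type*} [NormedAddCommGroup E]
    [InnerProductSpace ℝ E] [FiniteDimensional ℝ E] [MeasurableSpace E] [BorelSpace E]
    {μ : Measure E} [μ.IsAddHaarMeasure] [Nontrivial E] {Φ : E → E} {K : ℝ≥0}
    (hΦ : LipschitzWith K Φ) {U V O G : Set E} (hU : IsOpen U) (hUb : Bornology.IsBounded U)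
    (hV : IsOpen V) (hVc : IsPreconnected V) (hUV : ∀ z ∈ frontier U, Φ z ∉ V)
    (hO : MeasurableSet O) (hOU : O ⊆ U) (hinj : InjOn Φ O) (hG : IsOpen G) (hGn : G.Nonempty)
    (hGV : G ⊆ V) (hGO : G ⊆ Φ '' O) (hGU : ∀ x ∈ U, Φ x ∈ G → x ∈ O) :
    ∃ c : ℝ, (c = 1 ∨ c = -1) ∧ ∀ a ∈ V, ∃ r > 0, ∀ h : E → ℝ, Continuous h →
      tsupport h ⊆ Metric.ball a r →
        ∫ x in U, h (Φ x) * (fderiv ℝ Φ x).det ∂μ = c * ∫ y, h y ∂μ := by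
  have hfin : IsFiniteMeasure (μ.restrict U) :=
    ⟨by rw [Measure.restrict_apply_univ]; exact hUb.measure_lt_top⟩
  have hj : IntegrableOn (fun x => (fderiv ℝ Φ x).det) U μ :=
    hΦ.integrableOn_det_fderiv hUb.measure_lt_top.ne
  have hjm := measurable_det_fderiv Φ
  obtain ⟨c, hc⟩ := exists_integral_comp_mul_eq_const_mul (μ := μ) (ν := μ.restrict U)
    hΦ.continuous.measurable hj hV hVc fun g hg hgc hgV v =>
      hΦ.setIntegral_fderiv_mul_det_fderiv_eq_zero hU hUb hg hgc
        (fun z hz h => hUV z hz (hgV h)) v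
  refine ⟨c, ?_, hc⟩
  obtain ⟨a, ha⟩ := hGn
  obtain ⟨r₁, hr₁, hc₁⟩ := hc a (hGV ha)
  obtain ⟨r₂, hr₂, hr₂G⟩ := Metric.isOpen_iff.1 hG a ha
  set r := min r₁ r₂
  have hr : 0 < r := lt_min hr₁ hr₂
  have hrG : Metric.ball a r ⊆ G := (Metric.ball_subset_ball (min_le_right _ _)).trans hr₂G
  -- `fderiv` is zero where `Φ` is not differentiable, and then so is its determinant.
  have hdiff : ∀ x, (fderiv ℝ Φ x).det ≠ 0 → DifferentiableAt ℝ Φ x := by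
    intro x hx
    by_contra h
    rw [fderiv_zero_of_not_differentiableAt h] at hx
    exact hx (by simp [ContinuousLinearMap.det])
  set P : Set E := O ∩ {x | 0 < (fderiv ℝ Φ x).det}
  set N : Set E := O ∩ {x | (fderiv ℝ Φ x).det < 0}
  set Z : Set E := O ∩ {x | (fderiv ℝ Φ x).det = 0}
  have hPm : MeasurableSet P := hO.inter (measurableSet_lt measurable_const hjm)
  have hNm : MeasurableSet N := hO.inter (measurableSet_lt hjm measurable_const)
  have hZm : MeasurableSet Z := hO.inter (hjm (measurableSet_singleton 0))
  have hPd : ∀ x ∈ P, HasFDerivWithinAt Φ (fderiv ℝ Φ x) P x := fun x hx =>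
    (hdiff x (ne_of_gt hx.2)).hasFDerivAt.hasFDerivWithinAt
  have hNd : ∀ x ∈ N, HasFDerivWithinAt Φ (fderiv ℝ Φ x) N x := fun x hx =>
    (hdiff x (ne_of_lt hx.2)).hasFDerivAt.hasFDerivWithinAt
  have hPi : InjOn Φ P := hinj.mono inter_subset_left
  have hNi : InjOn Φ N := hinj.mono inter_subset_left
  have hPim := measurable_image_of_fderivWithin hPm hPd hPi
  have hNim := measurable_image_of_fderivWithin hNm hNd hNi
  have hZ0 : μ (Φ '' Z) = 0 := by
    rw [← hΦ.lintegral_abs_det_fderiv_eq_addHaar_image hZm (hinj.mono inter_subset_left)]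
    rw [setLIntegral_congr_fun (g := fun _ => 0) hZm fun x hx => by
      rw [show (fderiv ℝ Φ x).det = 0 from hx.2]; simp]
    simp
  have hform : ∀ g : E → ℝ, Continuous g → HasCompactSupport g → tsupport g ⊆ Metric.ball a r →
      ∫ x in U, g (Φ x) * (fderiv ℝ Φ x).det ∂μ
        = (∫ y in Φ '' P, g y ∂μ) - ∫ y in Φ '' N, g y ∂μ := by
    intro g hg hgc hgs
    obtain ⟨C, hC⟩ := hg.bounded_above_of_compact_support hgc
    have hint : IntegrableOn (fun x => g (Φ x) * (fderiv ℝ Φ x).det) U μ :=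
      integrable_comp_mul hΦ.continuous.measurable hj hg hC
    have hsplit : (P ∪ N) ⊆ U := union_subset (inter_subset_left.trans hOU)
      (inter_subset_left.trans hOU)
    have h0 : ∀ x ∈ U \ (P ∪ N), g (Φ x) * (fderiv ℝ Φ x).det = 0 := by
      rintro x ⟨hxU, hx⟩
      by_cases hg0 : g (Φ x) = 0
      · rw [hg0, zero_mul]
      · have hxO : x ∈ O := hGU x hxU (hrG (hgs (subset_tsupport g hg0)))
        rcases lt_trichotomy (fderiv ℝ Φ x).det 0 with h | h | h
        · exact absurd (Or.inr ⟨hxO, h⟩) hx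
        · rw [h, mul_zero]
        · exact absurd (Or.inl ⟨hxO, h⟩) hx
    have h1 := setIntegral_eq_of_subset_of_forall_sdiff_eq_zero (μ := μ) hU.measurableSet hsplit h0
    have hdisj : Disjoint P N := disjoint_left.2 fun x h h' =>
      lt_asymm (show 0 < (fderiv ℝ Φ x).det from h.2) h'.2
    rw [h1, setIntegral_union hdisj hNm (hint.mono_set (subset_union_left.trans hsplit))
      (hint.mono_set (subset_union_right.trans hsplit)),
      integral_image_eq_integral_abs_det_fderiv_smul μ hPm hPd hPi,
      integral_image_eq_integral_abs_det_fderiv_smul μ hNm hNd hNi, sub_eq_add_neg,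
      ← integral_neg]
    congr 1
    · refine setIntegral_congr_fun hPm fun x hx => ?_
      have : 0 < (fderiv ℝ Φ x).det := hx.2
      simp only [abs_of_pos this, smul_eq_mul, mul_comm]
    · refine setIntegral_congr_fun hNm fun x hx => ?_
      have : (fderiv ℝ Φ x).det < 0 := hx.2
      simp only [abs_of_neg this, smul_eq_mul]
      ring
  have hae : ∀ᵐ y ∂μ, y ∈ Metric.ball a r →
      (Φ '' P).indicator (1 : E → ℝ) y - (Φ '' N).indicator (1 : E → ℝ) y - c = 0 := by
    have hl1 : ∀ s : Set E, MeasurableSet s → LocallyIntegrable (s.indicator (1 : E → ℝ)) μ :=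
      fun s hs => (locallyIntegrable_const 1).indicator hs
    refine Metric.isOpen_ball.ae_eq_zero_of_integral_contDiff_smul_eq_zero
      ((((hl1 _ hPim).sub (hl1 _ hNim)).sub (locallyIntegrable_const c)).locallyIntegrableOn _)
      fun g hg hgc hgs => ?_
    have hgi : Integrable g μ := hg.continuous.integrable_of_hasCompactSupport hgc
    have h1 := hc₁ g hg.continuous (hgs.trans (Metric.ball_subset_ball (min_le_left _ _)))
    rw [hform g hg.continuous hgc hgs, ← integral_indicator hPim, ← integral_indicator hNim] at h1
    have h2 : ∀ y, g y • ((Φ '' P).indicator (1 : E → ℝ) y - (Φ '' N).indicator (1 : E → ℝ) y - c)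
        = (Φ '' P).indicator g y - (Φ '' N).indicator g y - c * g y := by
      intro y
      by_cases hyP : y ∈ Φ '' P <;> by_cases hyN : y ∈ Φ '' N <;>
        simp [hyP, hyN] <;> ring
    simp_rw [h2]
    have hPN : Integrable (fun y => (Φ '' P).indicator g y - (Φ '' N).indicator g y) μ :=
      (hgi.indicator hPim).sub (hgi.indicator hNim)
    rw [integral_sub hPN (hgi.const_mul c),
      integral_sub (hgi.indicator hPim) (hgi.indicator hNim), h1, integral_const_mul, sub_self]
  have hne : μ (Metric.ball a r) ≠ 0 := (Metric.measure_ball_pos μ a hr).ne'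
  obtain ⟨y, hy, hy1, hy2⟩ := ((frequently_ae_mem_iff.2 hne).and_eventually
    (hae.and (measure_eq_zero_iff_ae_notMem.1 hZ0))).exists
  have hy1 := hy1 hy
  obtain ⟨x, hxO, rfl⟩ := hGO (hrG hy)
  rcases lt_trichotomy (fderiv ℝ Φ x).det 0 with h | h | h
  · right
    have h1 : Φ x ∈ Φ '' N := ⟨x, ⟨hxO, h⟩, rfl⟩
    have h2 : Φ x ∉ Φ '' P := by
      rintro ⟨x', hx', hxx⟩
      have h3 : x' = x := hinj hx'.1 hxO hxx
      exact lt_asymm h (h3 ▸ hx'.2)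
    rw [indicator_of_mem h1, indicator_of_notMem h2] at hy1
    simp only [Pi.one_apply] at hy1
    linarith
  · exact absurd ⟨x, ⟨hxO, h⟩, rfl⟩ hy2
  · left
    have h1 : Φ x ∈ Φ '' P := ⟨x, ⟨hxO, h⟩, rfl⟩
    have h2 : Φ x ∉ Φ '' N := by
      rintro ⟨x', hx', hxx⟩
      have h3 : x' = x := hinj hx'.1 hxO hxx
      exact lt_asymm h (h3 ▸ hx'.2)
    rw [indicator_of_mem h1, indicator_of_notMem h2] at hy1
    simp only [Pi.one_apply] at hy1
    linarith

end Degree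

/-! ### The degree of the given map -/

section Jacobian

/-- The map `φ` extends to a Lipschitz map of the whole space, and its degree over `D` is `±1`. The
degree is computed just outside `D`, near a boundary point `q = φ p`: a suitable extension of
`φ` across `∂Ω` near `p` covers the outside of `D` near `q` exactly once, and the degree does
not change across `∂D` at `q`. -/
theorem exists_lipschitz_extension_integral_comp_mul_det {m : ℕ} (hm : m ≠ 0) {D Ω : Set (Euc m)}
    (hD : IsBoundedDomain D) (hΩ : IsBoundedDomain Ω)
    (hDb : HasC1Boundary D) (hΩb : HasC1Boundary Ω)
    {φ : Euc m → Euc m} (hφ : ContDiffOn ℝ 1 φ (closure Ω))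
    (hφm : MapsTo φ (closure Ω) (closure D))
    (hφb : MapsDiffeomorphically φ (frontier Ω) (frontier D)) :
    ∃ (K : NNReal) (Φ : Euc m → Euc m), LipschitzWith K Φ ∧ EqOn Φ φ (closure Ω) ∧
      ∃ c : ℝ, (c = 1 ∨ c = -1) ∧ ∀ a ∈ D, ∃ r > 0, ∀ h : Euc m → ℝ, Continuous h →
        tsupport h ⊆ Metric.ball a r →
          ∫ x in Ω, h (Φ x) * (fderiv ℝ Φ x).det = c * ∫ y, h y := by
  have : Nonempty (Fin m) := ⟨⟨0, Nat.pos_of_ne_zero hm⟩⟩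
  obtain ⟨-, hφf, ψ, hψ, hψm, hinv⟩ := hφb
  obtain ⟨K₀', hK₀'⟩ := hΩb.exists_lipschitzOnWith hΩ.isOpen hΩ.isBounded hφ
  obtain ⟨Φ₀, hΦ₀, hΦ₀φ⟩ := hK₀'.extend_finite_dimension
  have hfc : frontier Ω ⊆ closure Ω := frontier_subset_closure
  have hΦ₀f : EqOn φ Φ₀ (frontier Ω) := hΦ₀φ.mono hfc
  obtain ⟨p, hp⟩ : (frontier Ω).Nonempty := nonempty_frontier_iff.2 ⟨hΩ.isConnected.nonempty,
    fun h => NormedSpace.unbounded_univ ℝ (Euc m) (h ▸ hΩ.isBounded)⟩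
  set q := φ p with hq
  have hqf : q ∈ frontier D := hφf hp
  obtain ⟨A⟩ := hΩb.nonempty_boundaryChart hp
  obtain ⟨B⟩ := hDb.nonempty_boundaryChart hqf
  obtain ⟨K₁, s₀, hs₀, hLip, hagree, hout, hinj, hsurj⟩ := A.exists_extend B hp
    (Φ := Φ₀) (ψ := ψ) ⟨_, univ, Filter.univ_mem, hΦ₀.lipschitzOnWith⟩ (hΦ₀f hp).symm
    (hφf.congr hΦ₀f) hψm (hψ.continuousOn q hqf)
    ⟨fun x hx => by rw [← hΦ₀f hx]; exact hinv.1 hx,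
      fun y hy => by rw [← hΦ₀f (hψm hy)]; exact hinv.2 hy⟩
  set s := s₀ / 2 with hs
  have hs0 : 0 < s := half_pos hs₀
  have h2s : 2 * s = s₀ := by rw [hs]; ring
  obtain ⟨K, Φ, hΦ, hΦ0, hΦ1⟩ := LipschitzWith.exists_glue hp hs0 hΦ₀ (by rwa [h2s])
    (by rwa [h2s])
  have hΦφ : EqOn Φ φ (closure Ω) := fun x hx => (hΦ0 hx).trans (hΦ₀φ hx).symm
  have hss : Metric.closedBall p s ⊆ Metric.ball p s₀ :=
    Metric.closedBall_subset_ball (half_lt_self hs₀)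
  have hΦout : ∀ x ∈ Metric.closedBall p s, x ∉ closure Ω → Φ x ∉ closure D := by
    intro x hx hxc
    rw [hΦ1 ⟨hx, hxc⟩]
    exact hout x (hss hx) hxc
  set U := Ω ∪ Metric.ball p s with hU
  have hUo : IsOpen U := hΩ.isOpen.union Metric.isOpen_ball
  have hUb : Bornology.IsBounded U := hΩ.isBounded.union Metric.isBounded_ball
  -- The frontier of `U` consists of points of `∂Ω` other than `p` and of points outside `Ω`.
  have hUf : ∀ z ∈ frontier U, Φ z ∉ D ∧ Φ z ≠ q := by
    intro z hz
    have hzU : z ∉ U := fun h => hz.2 (by rwa [hUo.interior_eq])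
    by_cases hzc : z ∈ closure Ω
    · have hzf : z ∈ frontier Ω := by
        rw [hΩ.isOpen.frontier_eq]
        exact ⟨hzc, fun h => hzU (Or.inl h)⟩
      have h1 := hφf hzf
      rw [hΦφ hzc]
      refine ⟨fun h => ?_, fun h => ?_⟩
      · rw [hD.isOpen.frontier_eq] at h1
        exact h1.2 h
      · have : z = p := hinv.1.injOn hzf hp h
        exact hzU (Or.inr (this ▸ Metric.mem_ball_self hs0))
    · have hzs : z ∈ Metric.closedBall p s := by
        have := hz.1
        rw [hU, closure_union] at this
        exact Metric.closure_ball_subset_closedBall (this.resolve_left hzc)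
      have h1 := hΦout z hzs hzc
      exact ⟨fun h => h1 (subset_closure h), fun h => h1 (h ▸ hqf.1)⟩
  obtain ⟨r, hr, hrq⟩ : ∃ r > 0, Metric.ball q r ⊆ (Φ '' frontier U)ᶜ := by
    have hcomp : IsCompact (Φ '' frontier U) :=
      (hUb.isCompact_closure.of_isClosed_subset isClosed_frontier frontier_subset_closure).image
        hΦ.continuous
    refine Metric.isOpen_iff.1 hcomp.isClosed.isOpen_compl q ?_
    rintro ⟨z, hz, hzq⟩
    exact (hUf z hz).2 hzq
  obtain ⟨r', hr', hcover⟩ := hsurj s hs0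
  set V := D ∪ Metric.ball q r
  set O := Metric.ball p s \ closure Ω
  set G := Metric.ball q (min r r') \ closure D
  have hGn : G.Nonempty := by
    obtain ⟨y, hy1, hy2⟩ := mem_closure_iff.1 (B.mem_closure_compl_closure hqf) _
      Metric.isOpen_ball (Metric.mem_ball_self (lt_min hr hr'))
    exact ⟨y, hy1, hy2⟩
  have hΦO : EqOn Φ (A.extend B Φ₀) O := fun x hx => hΦ1 ⟨Metric.ball_subset_closedBall hx.1, hx.2⟩
  have hOs : O ⊆ Metric.ball p s₀ \ closure Ω := fun x hx =>
    ⟨hss (Metric.ball_subset_closedBall hx.1), hx.2⟩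
  obtain ⟨c, hc, hcV⟩ := hΦ.exists_degree_eq_one_or_neg_one (μ := volume) (U := U) (V := V) (O := O)
    (G := G) hUo hUb (hD.isOpen.union Metric.isOpen_ball)
    (by
      obtain ⟨y, hy1, hy2⟩ := mem_closure_iff.1 hqf.1 _ Metric.isOpen_ball
        (Metric.mem_ball_self hr)
      exact hD.isConnected.isPreconnected.union y hy2 hy1 (convex_ball q r).isPreconnected)
    (fun z hz h => h.elim (hUf z hz).1 fun h => hrq h ⟨z, hz, rfl⟩)
    (Metric.isOpen_ball.measurableSet.diff isClosed_closure.measurableSet)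
    (fun x hx => Or.inr hx.1)
    ((hinj.mono hOs).congr hΦO.symm)
    (Metric.isOpen_ball.sdiff isClosed_closure) hGn
    (fun y hy => Or.inr (Metric.ball_subset_ball (min_le_left _ _) hy.1))
    (by
      rw [hΦO.image_eq]
      exact fun y hy => hcover ⟨Metric.ball_subset_ball (min_le_right _ _) hy.1, hy.2⟩)
    (by
      rintro x hx ⟨-, hxG⟩
      have hxc : x ∉ closure Ω := fun h => hxG (by rw [hΦφ h]; exact hφm h)
      exact ⟨hx.resolve_left fun h => hxc (subset_closure h), hxc⟩)
  refine ⟨K, Φ, hΦ, hΦφ, c, hc, fun a ha => ?_⟩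
  obtain ⟨r₁, hr₁, h₁⟩ := hcV a (Or.inl ha)
  obtain ⟨r₂, hr₂, h₂⟩ := Metric.isOpen_iff.1 hD.isOpen a ha
  refine ⟨min r₁ r₂, lt_min hr₁ hr₂, fun h hh hs => ?_⟩
  rw [← h₁ h hh (hs.trans (Metric.ball_subset_ball (min_le_left _ _)))]
  refine (setIntegral_eq_of_subset_of_forall_sdiff_eq_zero hUo.measurableSet subset_union_left
    fun x hx => ?_).symm
  have hxD : Φ x ∉ D := by
    by_cases hxc : x ∈ closure Ω
    · have hxf : x ∈ frontier Ω := by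
        rw [hΩ.isOpen.frontier_eq]
        exact ⟨hxc, hx.2⟩
      have h3 := hφf hxf
      rw [hD.isOpen.frontier_eq] at h3
      rw [hΦφ hxc]
      exact h3.2
    · exact fun h => hΦout x (Metric.ball_subset_closedBall (hx.1.resolve_left hx.2)) hxc
        (subset_closure h)
  have : h (Φ x) = 0 := image_eq_zero_of_notMem_tsupport fun h3 =>
    hxD (h₂ (Metric.ball_subset_ball (min_le_right _ _) (hs h3)))
  rw [this, zero_mul]

end Jacobian

/-! ### Identification of measures -/

section Measures

open scoped NNReal

theorem MeasureTheory.Measure.restrict_ball_eq_of_integral_eq {E : Type*} [NormedAddCommGroup E]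
    [NormedSpace ℝ E] [FiniteDimensional ℝ E] [MeasurableSpace E] [BorelSpace E]
    {μ ν : Measure E} [IsLocallyFiniteMeasure μ] [IsLocallyFiniteMeasure ν] {a : E} {r : ℝ}
    (h : ∀ g : E → ℝ, Continuous g → tsupport g ⊆ Metric.ball a r → ∫ y, g y ∂μ = ∫ y, g y ∂ν) :
    μ.restrict (Metric.ball a r) = ν.restrict (Metric.ball a r) := by
  have hfin : ∀ (κ : Measure E) [IsLocallyFiniteMeasure κ],
      IsFiniteMeasure (κ.restrict (Metric.ball a r)) := fun κ _ =>
    ⟨by rw [Measure.restrict_apply_univ]; exact measure_ball_lt_top⟩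
  have := hfin μ
  have := hfin ν
  refine ext_of_forall_integral_eq_of_IsFiniteMeasure fun f => ?_
  let χ : ℕ → E → ℝ := fun n y => max (min ((n : ℝ) * (r - dist y a) - 1) 1) 0
  have hχc : ∀ n, Continuous (χ n) := fun n => by fun_prop
  have hχ1 : ∀ n y, |χ n y| ≤ 1 := fun n y => by
    rw [abs_of_nonneg (le_max_right _ _)]
    exact max_le (min_le_right _ _) zero_le_one
  have hχ0 : ∀ n y, χ n y ≠ 0 → 1 ≤ (n : ℝ) * (r - dist y a) := by
    intro n y hy
    by_contra! hlt
    exact hy (max_eq_right ((min_le_left _ _).trans (by linarith)))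
  have hχs : ∀ n, tsupport (χ n) ⊆ Metric.ball a r := by
    intro n y hy
    have hcl : IsClosed {y | 1 ≤ (n : ℝ) * (r - dist y a)} :=
      isClosed_le continuous_const (by fun_prop)
    have h1 : 1 ≤ (n : ℝ) * (r - dist y a) := closure_minimal (fun y hy => hχ0 n y hy) hcl hy
    have hn : (0 : ℝ) ≤ n := Nat.cast_nonneg n
    rw [Metric.mem_ball]
    by_contra! hge
    nlinarith
  have hlim : ∀ y, Filter.Tendsto (fun n => χ n y * f y) Filter.atTop
      (𝓝 ((Metric.ball a r).indicator f y)) := by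
    intro y
    by_cases hy : y ∈ Metric.ball a r
    · rw [indicator_of_mem hy]
      have hpos : 0 < r - dist y a := sub_pos.2 hy
      refine tendsto_const_nhds.congr' ?_
      filter_upwards [Filter.eventually_ge_atTop ⌈2 / (r - dist y a)⌉₊] with n hn
      have h1 : 2 ≤ (n : ℝ) * (r - dist y a) := by
        rw [← div_le_iff₀ hpos]
        exact Nat.ceil_le.1 hn
      have : χ n y = 1 := by
        simp only [χ]
        rw [min_eq_right (by linarith), max_eq_left zero_le_one]
      rw [this, one_mul]
    · rw [indicator_of_notMem hy]
      refine tendsto_const_nhds.congr fun n => ?_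
      rw [image_eq_zero_of_notMem_tsupport fun h' => hy (hχs n h'), zero_mul]
  have key : ∀ (κ : Measure E) [IsLocallyFiniteMeasure κ],
      Filter.Tendsto (fun n => ∫ y, χ n y * f y ∂κ) Filter.atTop
        (𝓝 (∫ y in Metric.ball a r, f y ∂κ)) := by
    intro κ _
    have := hfin κ
    rw [← integral_indicator Metric.isOpen_ball.measurableSet]
    refine tendsto_integral_of_dominated_convergence
      ((Metric.ball a r).indicator fun _ => ‖f‖) (fun n => ?_) ?_ (fun n => ?_) ?_
    · exact ((hχc n).mul f.continuous).measurable.aestronglyMeasurable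
    · exact (integrable_indicator_iff Metric.isOpen_ball.measurableSet).2 (integrable_const _)
    · refine Filter.Eventually.of_forall fun y => ?_
      by_cases hy : y ∈ Metric.ball a r
      · rw [indicator_of_mem hy, norm_mul]
        exact (mul_le_of_le_one_left (norm_nonneg _) (hχ1 n y)).trans (f.norm_coe_le_norm y)
      · rw [indicator_of_notMem hy,
          image_eq_zero_of_notMem_tsupport fun h' => hy (hχs n h'), zero_mul, norm_zero]
    · exact Filter.Eventually.of_forall hlim
  refine tendsto_nhds_unique (key μ)
    ((key ν).congr fun n => (h _ ((hχc n).mul f.continuous) ?_).symm)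
  exact (tsupport_mul_subset_left).trans (hχs n)

/-- Two locally finite measures which agree on continuous functions of small support in an open
set agree on that set. -/
theorem MeasureTheory.Measure.restrict_eq_of_locally_integral_eq {E : Type*} [NormedAddCommGroup E]
    [NormedSpace ℝ E] [FiniteDimensional ℝ E] [MeasurableSpace E] [BorelSpace E]
    {μ ν : Measure E} [IsLocallyFiniteMeasure μ] [IsLocallyFiniteMeasure ν] {D : Set E}
    (hD : IsOpen D)
    (h : ∀ a ∈ D, ∃ r > 0, ∀ g : E → ℝ, Continuous g → tsupport g ⊆ Metric.ball a r →
      ∫ y, g y ∂μ = ∫ y, g y ∂ν) :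
    μ.restrict D = ν.restrict D := by
  have h' : ∀ a ∈ D, ∃ r > 0, Metric.ball a r ⊆ D ∧
      μ.restrict (Metric.ball a r) = ν.restrict (Metric.ball a r) := by
    intro a ha
    obtain ⟨r₁, hr₁, h₁⟩ := h a ha
    obtain ⟨r₂, hr₂, h₂⟩ := Metric.isOpen_iff.1 hD a ha
    exact ⟨min r₁ r₂, lt_min hr₁ hr₂, (Metric.ball_subset_ball (min_le_right _ _)).trans h₂,
      Measure.restrict_ball_eq_of_integral_eq fun g hg hgs =>
        h₁ g hg (hgs.trans (Metric.ball_subset_ball (min_le_left _ _)))⟩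
  choose! r hr hrD hrμ using h'
  obtain ⟨t, htD, htc, ht⟩ := TopologicalSpace.countable_cover_nhdsWithin
    (f := fun a => Metric.ball a (r a)) (s := D)
    fun a ha => mem_nhdsWithin_of_mem_nhds (Metric.ball_mem_nhds a (hr a ha))
  have hDt : D = ⋃ a ∈ t, Metric.ball a (r a) :=
    ht.antisymm (iUnion₂_subset fun a ha => hrD a (htD ha))
  rw [hDt, Measure.restrict_biUnion_congr htc]
  exact fun a ha => hrμ a (htD ha)

/-- Near a point where the Jacobian determinant is nonzero the map is injective, so the preimage of
a null set consists, up to a null set, of critical points. -/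
theorem volume_preimage_inter_det_fderiv_ne_zero {m : ℕ} {Ω N : Set (Euc m)} (hΩ : IsOpen Ω)
    {Φ : Euc m → Euc m} (hΦm : Measurable Φ) (hΦ : ContDiffOn ℝ 1 Φ Ω) (hNm : MeasurableSet N)
    (hN : volume N = 0) : volume {x ∈ Ω | Φ x ∈ N ∧ (fderiv ℝ Φ x).det ≠ 0} = 0 := by
  set T := {x ∈ Ω | Φ x ∈ N ∧ (fderiv ℝ Φ x).det ≠ 0}
  have hjm := measurable_det_fderiv Φ
  have hTm : MeasurableSet T :=
    hΩ.measurableSet.inter ((hΦm hNm).inter (hjm (measurableSet_singleton 0).compl))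
  refine measure_null_of_locally_null _ fun x hx => ?_
  have hc : ContDiffAt ℝ 1 Φ x := hΦ.contDiffAt (hΩ.mem_nhds hx.1)
  have hd : HasFDerivAt Φ (((fderiv ℝ Φ x).toContinuousLinearEquivOfDetNeZero hx.2.2 :
      Euc m ≃L[ℝ] Euc m) : Euc m →L[ℝ] Euc m) x :=
    (hc.differentiableAt one_ne_zero).hasFDerivAt
  set e := hc.toOpenPartialHomeomorph Φ hd one_ne_zero
  have hxe : x ∈ e.source := hc.mem_toOpenPartialHomeomorph_source hd one_ne_zero
  refine ⟨T ∩ e.source, inter_mem_nhdsWithin _ (e.open_source.mem_nhds hxe), ?_⟩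
  have hm : MeasurableSet (T ∩ e.source) := hTm.inter e.open_source.measurableSet
  have h1 := lintegral_abs_det_fderiv_eq_addHaar_image volume hm
    (f := Φ) (f' := fderiv ℝ Φ)
    (fun y hy => ((hΦ.contDiffAt (hΩ.mem_nhds hy.1.1)).differentiableAt
      one_ne_zero).hasFDerivAt.hasFDerivWithinAt)
    (e.injOn.mono inter_subset_right)
  have h2 : volume (Φ '' (T ∩ e.source)) = 0 :=
    measure_mono_null (by rintro _ ⟨y, hy, rfl⟩; exact hy.1.2.1) hN
  rw [h2, lintegral_eq_zero_iff (by fun_prop), Filter.EventuallyEq, ae_restrict_iff' hm] at h1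
  refine measure_eq_zero_iff_ae_notMem.2 (h1.mono fun y hy hyT => hyT.1.2.2 ?_)
  have h3 := hy hyT
  rw [Pi.zero_apply, ENNReal.ofReal_eq_zero] at h3
  exact abs_nonpos_iff.1 h3

end Measures

theorem mainTheorem4 (m : ℕ) (hm : 2 ≤ m) (D Ω : Set (Euc m))
    (hD : IsBoundedDomain D) (hΩ : IsBoundedDomain Ω)
    (hDb : HasC1Boundary D) (hΩb : HasC1Boundary Ω)
    (hΩp : IsSinglyParametrized (frontier Ω))
    (φ : Euc m → Euc m) (hφ : ContDiffOn ℝ 1 φ (closure Ω))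
    (hφm : MapsTo φ (closure Ω) (closure D))
    (hφb : MapsDiffeomorphically φ (frontier Ω) (frontier D))
    (f : Euc m → ℝ) (hf : ContinuousOn f (closure D))
    (hJ : (∀ x ∈ Ω, 0 ≤ jacobianDet φ x) ∨ (∀ x ∈ Ω, jacobianDet φ x ≤ 0)) :
    IntegrableOn f D volume ∧
      IntegrableOn (fun x => f (φ x) * |jacobianDet φ x|) Ω volume ∧
      ∫ y in D, f y = ∫ x in Ω, f (φ x) * |jacobianDet φ x| := by
  obtain ⟨K, Φ, hΦ, hΦφ, c, hc, hcD⟩ :=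
    exists_lipschitz_extension_integral_comp_mul_det (by lia) hD hΩ hDb hΩb hφ hφm hφb
  have hloc : ∀ x ∈ Ω, Φ =ᶠ[𝓝 x] φ := fun x hx =>
    Filter.eventually_of_mem (hΩ.isOpen.mem_nhds hx) fun y hy => hΦφ (subset_closure hy)
  have hjac : ∀ x ∈ Ω, jacobianDet φ x = (fderiv ℝ Φ x).det := fun x hx => by
    rw [jacobianDet, (hloc x hx).fderiv_eq]
  have hjm := measurable_det_fderiv Φ
  have hΩm : MeasurableSet Ω := hΩ.isOpen.measurableSet
  obtain ⟨ε, hε, hεj⟩ : ∃ ε : ℝ, (ε = 1 ∨ ε = -1) ∧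
      ∀ x ∈ Ω, |(fderiv ℝ Φ x).det| = ε * (fderiv ℝ Φ x).det := by
    rcases hJ with h | h
    · exact ⟨1, Or.inl rfl, fun x hx => by
        rw [abs_of_nonneg (hjac x hx ▸ h x hx), one_mul]⟩
    · exact ⟨-1, Or.inr rfl, fun x hx => by
        rw [abs_of_nonpos (hjac x hx ▸ h x hx), neg_one_mul]⟩
  -- `κ` is the image of `|J_φ| dx`, to be identified with Lebesgue measure on `D`. It is defined by
  -- means of the extension `Φ`, since `φ` is arbitrary off the closure of `Ω`.
  set ν : Measure (Euc m) :=
    (volume.restrict Ω).withDensity fun x => (‖(fderiv ℝ Φ x).det‖₊ : ENNReal) with hν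
  have hνfin : IsFiniteMeasure ν := by
    refine isFiniteMeasure_withDensity ?_
    exact (hΦ.integrableOn_det_fderiv hΩ.isBounded.measure_lt_top.ne).2.ne
  set κ : Measure (Euc m) := ν.map Φ with hκ
  have hΦm : Measurable Φ := hΦ.continuous.measurable
  have hκint : ∀ g : Euc m → ℝ, AEStronglyMeasurable g κ →
      ∫ y, g y ∂κ = ∫ x in Ω, g (Φ x) * |(fderiv ℝ Φ x).det| := by
    intro g hg
    rw [hκ, integral_map hΦm.aemeasurable hg, hν,
      integral_withDensity_eq_integral_smul hjm.nnnorm]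
    refine integral_congr_ae (Filter.Eventually.of_forall fun x => ?_)
    simp only [NNReal.smul_def, coe_nnnorm, Real.norm_eq_abs, smul_eq_mul, mul_comm]
  have hκD : ∀ a ∈ D, ∃ r > 0, ∀ g : Euc m → ℝ, Continuous g → tsupport g ⊆ Metric.ball a r →
      ∫ y, g y ∂κ = ε * c * ∫ y, g y := by
    intro a ha
    obtain ⟨r, hr, h⟩ := hcD a ha
    refine ⟨r, hr, fun g hg hgs => ?_⟩
    rw [hκint g hg.aestronglyMeasurable, mul_assoc, ← h g hg hgs, ← integral_const_mul]
    refine setIntegral_congr_fun hΩm fun x hx => ?_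
    simp only [hεj x hx]
    ring
  -- The value `-1` is excluded since `κ` is a positive measure.
  have hεc : ε * c = 1 := by
    obtain ⟨a, ha⟩ := hD.isConnected.nonempty
    obtain ⟨r, hr, h⟩ := hκD a ha
    let b : ContDiffBump a := ⟨r / 4, r / 2, by positivity, by linarith⟩
    have h1 := h (b.normed volume) b.continuous_normed (by
      rw [ContDiffBump.tsupport_normed_eq]
      exact Metric.closedBall_subset_ball (half_lt_self hr))
    rw [ContDiffBump.integral_normed, mul_one] at h1
    have h2 : 0 ≤ ε * c := h1 ▸ integral_nonneg fun y => b.nonneg_normed y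
    rcases hε with rfl | rfl <;> rcases hc with rfl | rfl <;>
      first
        | norm_num; done
        | exact absurd h2 (by norm_num)
  simp only [hεc, one_mul] at hκD
  have hκD' : κ.restrict D = volume.restrict D :=
    Measure.restrict_eq_of_locally_integral_eq hD.isOpen hκD
  -- `φ` maps into `closure D`, and `κ` has no mass on the null set `∂D`.
  have hκc : ∀ᵐ y ∂κ, y ∈ D := by
    have h0 := volume_preimage_inter_det_fderiv_ne_zero hΩ.isOpen hΦm
      ((hφ.mono subset_closure).congr fun x hx => hΦφ (subset_closure hx))
      isClosed_frontier.measurableSet hDb.volume_frontier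
    rw [hκ, ae_map_iff (p := fun y => y ∈ D) hΦm.aemeasurable hD.isOpen.measurableSet, hν,
      ae_withDensity_iff hjm.nnnorm.coe_nnreal_ennreal, ae_restrict_iff' hΩm]
    filter_upwards [measure_eq_zero_iff_ae_notMem.1 h0] with x hx hxΩ hxj
    by_contra hxD
    refine hx ⟨hxΩ, ?_, by simpa using hxj⟩
    rw [hD.isOpen.frontier_eq]
    exact ⟨hΦφ (subset_closure hxΩ) ▸ hφm (subset_closure hxΩ), hxD⟩
  have hκvol : κ = volume.restrict D := by
    rw [← hκD', Measure.restrict_eq_self_of_ae_mem hκc]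
  have hfD : IntegrableOn f D volume :=
    (hf.integrableOn_compact hD.isBounded.isCompact_closure).mono_set subset_closure
  have hfκ : Integrable f κ := hκvol ▸ hfD
  have hcongr : ∀ x ∈ Ω, f (Φ x) * |(fderiv ℝ Φ x).det| = f (φ x) * |jacobianDet φ x| :=
    fun x hx => by rw [hΦφ (subset_closure hx), hjac x hx]
  refine ⟨hfD, ?_, ?_⟩
  · have h1 := (integrable_map_measure hfκ.1 hΦm.aemeasurable).1 hfκ
    rw [hν, integrable_withDensity_iff_integrable_smul hjm.nnnorm] at h1
    refine IntegrableOn.congr_fun h1 (fun x hx => ?_) hΩm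
    rw [← hcongr x hx]
    simp only [NNReal.smul_def, coe_nnnorm, Real.norm_eq_abs, smul_eq_mul, mul_comm,
      Function.comp]
  · rw [← setIntegral_congr_fun hΩm hcongr, ← hκint f hfκ.1, hκvol]
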